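/- Let $p$ be a prime, let $F$ be a finite extension of $\mathbf{Q}_p$ with ring of integers $\mathcal{O}_F$, uniformizer $\pi$ and residue field $k_F$ of cardinality $q$, and let $\mathbf{C}_F$ be the completion of an algebraic closure of $F$, with ring of integers $\mathcal{O}_{\mathbf{C}_F}$. For an $\mathcal{O}_F$-algebra $R$ let $W_\pi(R)$ be the $\mathcal{O}_F$-algebra of ramified Witt vectors: as a set it is $R^{\mathbf{N}}$, functorially in $R$, and the ghost map $(a_0,a_1,\dots)\mapsto\bigl(\sum_{i\le n}\pi^i a_i^{q^{n-i}}\bigr)_n$ is a homomorphism $W_\pi(R)\to R^{\mathbf{N}}$, natural in $R$. Let $\mathrm{Fr}$ be its Frobenius, the natural endomorphism that shifts the ghost components, $(w_0,w_1,\dots)\mapsto(w_1,w_2,\dots)$. Let $W$ denote the usual $p$-typical Witt vectors. Put $\widetilde{\mathbf{E}}^+=\varprojlim_{x\mapsto x^p}\mathcal{O}_{\mathbf{C}_F}/(p)$, which is identified with $E_q:=\varprojlim_{x\mapsto x^q}\mathcal{O}_{\mathbf{C}_F}/(\pi)$ by the isomorphism $(x_n)_n\mapsto(x_{an}\bmod\pi)_n$,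 where $q=p^a$; it is a $k_F$-algebra, the structure map of $E_q$ being given by constant sequences. (1) Every $z\in W(E_q)\otimes_{W(k_F)}\mathcal{O}_F$ is in a unique way a $\pi$-adically convergent sum $z=\sum_{i\ge0}\pi^i[a_i]$ with $a_i=(a_{ij})_j\in E_q$ and $[a_i]$ the Teichmüller lift. For any lifts $\widetilde{a_{ij}}\in\mathcal{O}_{\mathbf{C}_F}$ of $a_{ij}$ the limits $\lim_j\widetilde{a_{ij}}^{\,q^j}$ exist and do not depend on the lifts, and the sum $$\theta(z)=\sum_{i\ge0}\pi^i\lim_{j\to\infty}\widetilde{a_{ij}}^{\,q^j}$$ converges in $\mathcal{O}_{\mathbf{C}_F}$. This defines Fontaine's map $\theta:W(E_q)\otimes_{W(k_F)}\mathcal{O}_F\to\mathcal{O}_{\mathbf{C}_F}$. (2) In the chain $$\varprojlim_{\mathrm{Fr}}W_\pi(\mathcal{O}_{\mathbf{C}_F})\xrightarrow{\ \varpi\ }\varprojlim_{\mathrm{Fr}}W_\pi(\mathcal{O}_{\mathbf{C}_F}/(\pi))\xrightarrow{\ \alpha\ }W_\pi(E_q)\xrightarrow{\ \gamma\ }W(\widetilde{\mathbf{E}}^+)\otimes_{W(k_F)}\mathcal{O}_F$$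 all maps are isomorphisms of $\mathcal{O}_F$-algebras. Here $\varpi$ is reduction modulo $\pi$ of all Witt components; $\alpha$ interchanges the indices (the $j$-th term of the $i$-th Witt component of $\alpha(\underline{x})$ is the $i$-th Witt component of the $j$-th term of $\underline{x}$); and $\gamma$ is the unique isomorphism of $\mathcal{O}_F$-algebras that induces the identification $E_q\cong\widetilde{\mathbf{E}}^+$ of the residue rings modulo $\pi$, that is, $\gamma(w)\equiv[w_0]\otimes1$ modulo $1\otimes\pi$ for every $w=(w_0,w_1,\dots)$. (3) Under $\gamma\circ\alpha\circ\varpi$, and the isomorphism $W(\widetilde{\mathbf{E}}^+)\otimes_{W(k_F)}\mathcal{O}_F\cong W(E_q)\otimes_{W(k_F)}\mathcal{O}_F$ given by $\widetilde{\mathbf{E}}^+\cong E_q$, the map $\theta$ corresponds to the ring homomorphism $$\varprojlim_{\mathrm{Fr}}W_\pi(\mathcal{O}_{\mathbf{C}_F})\to\mathcal{O}_{\mathbf{C}_F},\qquad \underline{x}=(\underline{x}_1,\underline{x}_q,\underline{x}_{q^2},\dots)\mapsto x_{q^0 0},$$ which sends a compatible system to the zeroth Witt component of its first term: $\theta(\gamma(\alpha(\varpi(\underline{x}))))=x_{q^0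 0}$ for all $\underline{x}$. -/

import Mathlib

namespace RamifiedWitt

open MvPolynomial Finset

/-- Standing assumptions on the base ring `A`, the element `π` and the integer `q`: these are the
properties of the ring of integers of a local field, of a uniformizer, and of the cardinality of the
residue field, that make the ramified Witt vector functor exist. -/
class Base (A : Type*) [CommRing A] (π : A) (q : ℕ) : Prop where
  regular : ∀ a : A, π * a = 0 → a = 0
  dvd_pow_sub : ∀ a : A, π ∣ a ^ q - a
  exists_prime : ∃ p f : ℕ, p.Prime ∧ 0 < f ∧ q = p ^ f ∧ π ∣ (p : A)

/-- The `n`-th ghost component `∑_{i ≤ n} π^i x_i^{q^(n-i)}` of a sequence `x`. -/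
def ghost {A : Type*} [CommRing A] (π : A) (q : ℕ) {R : Type*} [CommRing R] [Algebra A R]
    (x : ℕ → R) (n : ℕ) : R :=
  ∑ i ∈ range (n + 1), algebraMap A R π ^ i * x i ^ q ^ (n - i)

/-- The sequence whose ghost components are `y`, when there is exactly one. -/
noncomputable def unghost {A : Type*} [CommRing A] (π : A) (q : ℕ) {R : Type*} [CommRing R]
    [Algebra A R] (y : ℕ → R) : ℕ → R
  | n => Classical.epsilon fun c => algebraMap A R π ^ n * c =
      y n - ∑ i : Fin n, algebraMap A R π ^ (i : ℕ) * unghost π q y i ^ q ^ (n - i)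

section dwork

variable {A : Type*} [CommRing A] {π : A} {q : ℕ}

theorem ghost_zero {R : Type*} [CommRing R] [Algebra A R] (x : ℕ → R) :
    ghost π q x 0 = x 0 := by simp [ghost]

theorem map_ghost {R S : Type*} [CommRing R] [Algebra A R] [CommRing S] [Algebra A S]
    (f : R →ₐ[A] S) (x : ℕ → R) (n : ℕ) :
    f (ghost π q x n) = ghost π q (fun i => f (x i)) n := by
  simp [ghost, map_sum, map_mul, map_pow]

theorem ghost_succ {R : Type*} [CommRing R] [Algebra A R] (x : ℕ → R) (n : ℕ) :
    ghost π q x (n + 1) = ghost π q (fun i => x i ^ q) n + algebraMap A R π ^ (n + 1) * x (n + 1) := by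
  unfold ghost
  rw [sum_range_succ]
  congr 1
  · refine sum_congr rfl fun i hi => ?_
    have : i ≤ n := by simpa [Nat.lt_succ_iff] using hi
    rw [← pow_mul, ← pow_succ', Nat.succ_sub this]
  · simp

theorem one_lt [Base A π q] : 1 < q := by
  obtain ⟨p, f, hp, hf, rfl, -⟩ := Base.exists_prime (A := A) (π := π) (q := q)
  exact Nat.one_lt_pow hf.ne' hp.one_lt

theorem dvd_q [Base A π q] : π ∣ (q : A) := by
  obtain ⟨p, f, hp, hf, h, h'⟩ := Base.exists_prime (A := A) (π := π) (q := q)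
  rw [h, Nat.cast_pow]
  exact dvd_pow h' hf.ne'

variable {R : Type*} [CommRing R] [Algebra A R]

theorem pow_q_congr [Base A π q] {a b : R} {i : ℕ}
    (h : algebraMap A R π ^ (i + 1) ∣ a - b) : algebraMap A R π ^ (i + 2) ∣ a ^ q - b ^ q := by
  rw [← geom_sum₂_mul, pow_succ' _ (i + 1)]
  refine mul_dvd_mul ?_ h
  rw [dvd_geom_sum₂_iff_of_dvd_sub ((dvd_pow_self _ (by simp)).trans h)]
  refine Dvd.dvd.mul_right ?_ _
  simpa using map_dvd (algebraMap A R) (dvd_q (A := A) (π := π) (q := q))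

theorem pow_q_pow_congr [Base A π q] {a b : R} (h : algebraMap A R π ∣ a - b) (j : ℕ) :
    algebraMap A R π ^ (j + 1) ∣ a ^ q ^ j - b ^ q ^ j := by
  induction j with
  | zero => simpa using h
  | succ j ih => rw [pow_succ q j, pow_mul, pow_mul]; exact pow_q_congr ih

theorem dvd_ghost_sub [Base A π q] {x y : ℕ → R} {n : ℕ}
    (h : ∀ i ≤ n, algebraMap A R π ∣ x i - y i) :
    algebraMap A R π ^ (n + 1) ∣ ghost π q x n - ghost π q y n := by
  unfold ghost
  rw [← sum_sub_distrib]
  refine dvd_sum fun i hi => ?_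
  have hi : i ≤ n := by simpa [Nat.lt_succ_iff] using hi
  rw [← mul_sub]
  have : n + 1 = i + (n - i + 1) := by omega
  rw [this, pow_add]
  exact mul_dvd_mul_left _ (pow_q_pow_congr (h i hi) _)

/-- The Dwork congruences: if `φ` lifts the `q`-power Frobenius and
`y (n+1) ≡ φ (y n)` modulo `π^(n+1)` for all `n`, then `y` is a sequence of ghost components. -/
theorem ghost_unghost [Base A π q] (φ : R →ₐ[A] R)
    (hφ : ∀ b, algebraMap A R π ∣ φ b - b ^ q) (y : ℕ → R)
    (hy : ∀ n, algebraMap A R π ^ (n + 1) ∣ y (n + 1) - φ (y n)) (n : ℕ) :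
    ghost π q (unghost π q y) n = y n := by
  have key : ∀ n, (∃ c, algebraMap A R π ^ n * c =
      y n - ∑ i : Fin n, algebraMap A R π ^ (i : ℕ) * unghost π q y i ^ q ^ (n - i)) →
      ghost π q (unghost π q y) n = y n := by
    intro n h
    have h' := Classical.epsilon_spec h
    rw [ghost, sum_range_succ, ← Fin.sum_univ_eq_sum_range
      (fun i => algebraMap A R π ^ i * unghost π q y i ^ q ^ (n - i))]
    conv_lhs => arg 2; rw [unghost]
    rw [Nat.sub_self, pow_zero, pow_one, h']
    ring
  induction n with
  | zero => exact key 0 ⟨y 0, by simp⟩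
  | succ n ih =>
    apply key
    obtain ⟨c, hc⟩ := hy n
    obtain ⟨d, hd⟩ := dvd_ghost_sub (A := A) (π := π) (q := q) (n := n)
      (x := fun i => φ (unghost π q y i)) (y := fun i => unghost π q y i ^ q) (fun i _ => hφ _)
    rw [← map_ghost, ih] at hd
    refine ⟨c + d, ?_⟩
    rw [Fin.sum_univ_eq_sum_range
      (fun i => algebraMap A R π ^ i * unghost π q y i ^ q ^ (n + 1 - i))]
    have e : ∑ i ∈ range (n + 1), algebraMap A R π ^ i * unghost π q y i ^ q ^ (n + 1 - i)
        = ghost π q (fun i => unghost π q y i ^ q) n := by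
      refine sum_congr rfl fun i hi => ?_
      have : i ≤ n := by simpa [Nat.lt_succ_iff] using hi
      rw [← pow_mul, ← pow_succ', Nat.succ_sub this]
    rw [e, mul_add, ← hc, ← hd]
    ring

theorem ghost_injective (hR : ∀ b : R, algebraMap A R π * b = 0 → b = 0) {x y : ℕ → R}
    (h : ∀ n, ghost π q x n = ghost π q y n) : x = y := by
  have hR' : ∀ (n : ℕ) (b c : R), algebraMap A R π ^ n * b = algebraMap A R π ^ n * c → b = c := by
    intro n
    induction n with
    | zero => simp
    | succ n ih =>
      intro b c hbc
      refine ih _ _ (sub_eq_zero.1 (hR _ ?_))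
      rw [mul_sub, ← mul_assoc, ← mul_assoc, ← pow_succ', hbc, sub_self]
  funext n
  induction n using Nat.strong_induction_on with
  | _ n ih =>
    have := h n
    unfold ghost at this
    rw [sum_range_succ, sum_range_succ, sum_congr rfl
      (fun i hi => by rw [ih i (by simpa using hi)])] at this
    simpa using hR' n _ _ (by simpa using this)

/-- The `A`-algebra endomorphism `X_s ↦ X_s^q` of a polynomial ring. -/
noncomputable def polyFrob (A : Type*) [CommRing A] (q : ℕ) (σ : Type*) :
    MvPolynomial σ A →ₐ[A] MvPolynomial σ A :=
  aeval fun s => X s ^ q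

theorem dvd_add_pow [Base A π q] (a b : R) :
    algebraMap A R π ∣ (a + b) ^ q - (a ^ q + b ^ q) := by
  obtain ⟨p, f, hp, hf, h, h'⟩ := Base.exists_prime (A := A) (π := π) (q := q)
  subst h
  obtain ⟨c, hc⟩ := exists_add_pow_prime_pow_eq hp a b f
  rw [hc, add_sub_cancel_left]
  have h2 : algebraMap A R π ∣ (p : R) := by simpa using map_dvd (algebraMap A R) h'
  rw [mul_assoc, mul_assoc]
  exact h2.mul_right _

theorem polyFrob_dvd [Base A π q] {σ : Type*} (f : MvPolynomial σ A) :
    algebraMap A (MvPolynomial σ A) π ∣ polyFrob A q σ f - f ^ q := by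
  induction f using MvPolynomial.induction_on with
  | C a =>
    have := map_dvd (C (σ := σ)) (Base.dvd_pow_sub (π := π) (q := q) a)
    rw [← dvd_neg]
    simpa [polyFrob, algebraMap_eq] using this
  | add f g hf hg =>
    have := (dvd_add hf hg).sub (dvd_add_pow (π := π) (q := q) f g)
    convert this using 1
    rw [map_add]; ring
  | mul_X f s hf =>
    have : polyFrob A q σ (f * X s) - (f * X s) ^ q = (polyFrob A q σ f - f ^ q) * X s ^ q := by
      simp [polyFrob]; ring
    rw [this]
    exact hf.mul_right _

theorem poly_regular [Base A π q] {σ : Type*} (f : MvPolynomial σ A)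
    (h : algebraMap A (MvPolynomial σ A) π * f = 0) : f = 0 := by
  ext m
  have := congrArg (coeff m) h
  rw [algebraMap_eq, coeff_C_mul, coeff_zero] at this
  simpa using Base.regular (π := π) (q := q) _ this

end dwork

/-! ### Universal polynomials -/

section universal

variable (A : Type*) [CommRing A] (π : A) (q : ℕ)

/-- The polynomials giving addition of ramified Witt vectors. -/
noncomputable def addPoly : ℕ → MvPolynomial (Fin 2 × ℕ) A :=
  unghost π q fun n => ghost π q (fun i => X (0, i)) n + ghost π q (fun i => X (1, i)) n

/-- The polynomials giving multiplication of ramified Witt vectors. -/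
noncomputable def mulPoly : ℕ → MvPolynomial (Fin 2 × ℕ) A :=
  unghost π q fun n => ghost π q (fun i => X (0, i)) n * ghost π q (fun i => X (1, i)) n

/-- The polynomials giving negation of ramified Witt vectors. -/
noncomputable def negPoly : ℕ → MvPolynomial ℕ A :=
  unghost π q fun n => -ghost π q (fun i => X i) n

/-- The polynomials giving the Frobenius of ramified Witt vectors. -/
noncomputable def frobPoly : ℕ → MvPolynomial ℕ A :=
  unghost π q fun n => ghost π q (fun i => X i) (n + 1)

/-- The Witt components of the element `a` of the base ring. -/
noncomputable def constSeq (a : A) : ℕ → A := unghost π q fun _ => a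

theorem dwork_X {σ : Type*} (s : ℕ → σ) (n : ℕ) :
    algebraMap A (MvPolynomial σ A) π ^ (n + 1) ∣
      ghost π q (fun i => X (R := A) (s i)) (n + 1)
        - polyFrob A q σ (ghost π q (fun i => X (s i)) n) := by
  rw [map_ghost, ghost_succ]
  simp [polyFrob]

variable [Base A π q]

theorem ghost_addPoly (n : ℕ) : ghost π q (addPoly A π q) n =
    ghost π q (fun i => X (0, i)) n + ghost π q (fun i => X (1, i)) n := by
  refine ghost_unghost (polyFrob A q _) polyFrob_dvd _ (fun n => ?_) n
  rw [map_add, add_sub_add_comm]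
  exact dvd_add (dwork_X A π q _ n) (dwork_X A π q _ n)

theorem ghost_mulPoly (n : ℕ) : ghost π q (mulPoly A π q) n =
    ghost π q (fun i => X (0, i)) n * ghost π q (fun i => X (1, i)) n := by
  refine ghost_unghost (polyFrob A q _) polyFrob_dvd _ (fun n => ?_) n
  have h0 := dwork_X A π q (fun i => ((0 : Fin 2), i)) n
  have h1 := dwork_X A π q (fun i => ((1 : Fin 2), i)) n
  have := dvd_add (h0.mul_right (ghost π q (fun i => X (1, i)) (n + 1)))
    (h1.mul_left (polyFrob A q _ (ghost π q (fun i => X (0, i)) n)))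
  convert this using 1
  rw [map_mul]; ring

theorem ghost_negPoly (n : ℕ) : ghost π q (negPoly A π q) n =
    -ghost π q (fun i => X i) n := by
  refine ghost_unghost (polyFrob A q _) polyFrob_dvd _ (fun n => ?_) n
  rw [map_neg, ← neg_sub', dvd_neg]
  exact dwork_X A π q _ n

theorem ghost_frobPoly (n : ℕ) : ghost π q (frobPoly A π q) n =
    ghost π q (fun i => X i) (n + 1) := by
  refine ghost_unghost (polyFrob A q _) polyFrob_dvd _ (fun n => ?_) n
  exact (pow_dvd_pow _ (by simp)).trans (dwork_X A π q _ (n + 1))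

theorem ghost_constSeq (a : A) (n : ℕ) : ghost π q (constSeq A π q a) n = a := by
  refine ghost_unghost (AlgHom.id A A) (fun b => ?_) _ (fun n => ?_) n
  · rw [← dvd_neg]; simpa using Base.dvd_pow_sub (π := π) (q := q) b
  · simp

/-- Modulo `π`, the Frobenius raises each component to the `q`-th power. -/
theorem frobPoly_dvd (n : ℕ) :
    algebraMap A (MvPolynomial ℕ A) π ∣ frobPoly A π q n - X n ^ q := by
  induction n using Nat.strong_induction_on with
  | _ n ih =>
    have h := ghost_frobPoly A π q n
    rw [ghost_succ] at h
    unfold ghost at h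
    rw [sum_range_succ, sum_range_succ] at h
    simp only [Nat.sub_self, pow_zero, pow_one] at h
    have hd : algebraMap A (MvPolynomial ℕ A) π ^ (n + 1) ∣
        ∑ i ∈ range n, algebraMap A (MvPolynomial ℕ A) π ^ i * frobPoly A π q i ^ q ^ (n - i) -
        ∑ i ∈ range n, algebraMap A (MvPolynomial ℕ A) π ^ i * (X i ^ q) ^ q ^ (n - i) := by
      rw [← sum_sub_distrib]
      refine dvd_sum fun i hi => ?_
      have hi : i < n := by simpa using hi
      rw [← mul_sub]
      have e : n + 1 = i + (n - i + 1) := by omega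
      rw [e, pow_add]
      exact mul_dvd_mul_left _ (pow_q_pow_congr (ih i hi) _)
    obtain ⟨c, hc⟩ := hd
    have h2 : algebraMap A (MvPolynomial ℕ A) π ^ n * (frobPoly A π q n - X n ^ q
        - algebraMap A (MvPolynomial ℕ A) π * (X (n + 1) - c)) = 0 := by
      rw [pow_succ] at hc h
      linear_combination h - hc
    have h3 : ∀ (m : ℕ) (f : MvPolynomial ℕ A),
        algebraMap A (MvPolynomial ℕ A) π ^ m * f = 0 → f = 0 := by
      intro m
      induction m with
      | zero => simp
      | succ m ihm =>
        intro f hf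
        exact ihm f (poly_regular (π := π) (q := q) _ (by rw [← mul_assoc, ← pow_succ', hf]))
    rw [sub_eq_zero.1 (h3 n _ h2)]
    exact dvd_mul_right _ _

end universal

/-! ### The ring of ramified Witt vectors -/

/-- Ramified Witt vectors `W_π(R)` of an `A`-algebra `R`: as a set, sequences of elements of `R`. -/
@[ext]
structure Witt (A : Type*) [CommRing A] (π : A) (q : ℕ) (R : Type*) where
  /-- The Witt components. -/
  coeff : ℕ → R

namespace Witt

section ops

variable {A : Type*} [CommRing A] {π : A} {q : ℕ} {R S : Type*} [CommRing R] [Algebra A R]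
  [CommRing S] [Algebra A S]

instance : Zero (Witt A π q R) := ⟨⟨fun _ => 0⟩⟩

instance : One (Witt A π q R) := ⟨⟨fun n => if n = 0 then 1 else 0⟩⟩

noncomputable instance : Add (Witt A π q R) :=
  ⟨fun x y => ⟨fun n => aeval (fun s : Fin 2 × ℕ => (![x.coeff, y.coeff] s.1) s.2)
    (addPoly A π q n)⟩⟩

noncomputable instance : Mul (Witt A π q R) :=
  ⟨fun x y => ⟨fun n => aeval (fun s : Fin 2 × ℕ => (![x.coeff, y.coeff] s.1) s.2)
    (mulPoly A π q n)⟩⟩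

noncomputable instance : Neg (Witt A π q R) :=
  ⟨fun x => ⟨fun n => aeval x.coeff (negPoly A π q n)⟩⟩

/-- The effect on components of an algebra homomorphism. -/
def mapFun (f : R →ₐ[A] S) (x : Witt A π q R) : Witt A π q S := ⟨fun n => f (x.coeff n)⟩

/-- The Frobenius, as a function. -/
noncomputable def frobFun (x : Witt A π q R) : Witt A π q R :=
  ⟨fun n => aeval x.coeff (frobPoly A π q n)⟩

/-- The image of an element of the base ring, as a Witt vector. -/
noncomputable def const (A : Type*) [CommRing A] (π : A) (q : ℕ) (R : Type*) [CommRing R]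
    [Algebra A R] (a : A) : Witt A π q R :=
  ⟨fun n => algebraMap A R (constSeq A π q a n)⟩

theorem mapFun_zero (f : R →ₐ[A] S) : mapFun f (0 : Witt A π q R) = 0 := by
  ext n; exact map_zero f

theorem mapFun_one (f : R →ₐ[A] S) : mapFun f (1 : Witt A π q R) = 1 := by
  ext n
  change f (if n = 0 then 1 else 0) = if n = 0 then 1 else 0
  split_ifs <;> simp

theorem mapFun_add (f : R →ₐ[A] S) (x y : Witt A π q R) :
    mapFun f (x + y) = mapFun f x + mapFun f y := by
  ext n
  change f (aeval _ _) = aeval _ _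
  rw [← AlgHom.comp_apply, comp_aeval]
  congr 2
  funext ⟨s, i⟩
  fin_cases s <;> rfl

theorem mapFun_mul (f : R →ₐ[A] S) (x y : Witt A π q R) :
    mapFun f (x * y) = mapFun f x * mapFun f y := by
  ext n
  change f (aeval _ _) = aeval _ _
  rw [← AlgHom.comp_apply, comp_aeval]
  congr 2
  funext ⟨s, i⟩
  fin_cases s <;> rfl

theorem mapFun_neg (f : R →ₐ[A] S) (x : Witt A π q R) :
    mapFun f (-x) = -mapFun f x := by
  ext n
  change f (aeval _ _) = aeval _ _
  rw [← AlgHom.comp_apply, comp_aeval]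
  rfl

theorem mapFun_frobFun (f : R →ₐ[A] S) (x : Witt A π q R) :
    mapFun f (frobFun x) = frobFun (mapFun f x) := by
  ext n
  change f (aeval _ _) = aeval _ _
  rw [← AlgHom.comp_apply, comp_aeval]
  rfl

theorem mapFun_const (f : R →ₐ[A] S) (a : A) :
    mapFun f (const A π q R a) = const A π q S a := by
  ext n; exact f.commutes _

theorem exists_lift (x : Witt A π q R) :
    ∃ x' : Witt A π q (MvPolynomial R A), mapFun (aeval id) x' = x :=
  ⟨⟨fun n => X (x.coeff n)⟩, by ext n; simp [mapFun]⟩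

variable [Base A π q]

theorem ghost_zero' (n : ℕ) : ghost π q (0 : Witt A π q R).coeff n = 0 := by
  have h : q ≠ 0 := (zero_lt_one.trans (one_lt (A := A) (π := π))).ne'
  refine sum_eq_zero fun i _ => ?_
  change _ * (0 : R) ^ _ = 0
  rw [zero_pow (pow_ne_zero _ h), mul_zero]

theorem ghost_one (n : ℕ) : ghost π q (1 : Witt A π q R).coeff n = 1 := by
  have h : q ≠ 0 := (zero_lt_one.trans (one_lt (A := A) (π := π))).ne'
  unfold ghost
  rw [sum_range_succ']
  change _ + _ * (1 : R) ^ _ = 1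
  rw [sum_eq_zero]
  · simp
  · intro i _
    change _ * (0 : R) ^ _ = 0
    rw [zero_pow (pow_ne_zero _ h), mul_zero]

theorem ghost_add (x y : Witt A π q R) (n : ℕ) :
    ghost π q (x + y).coeff n = ghost π q x.coeff n + ghost π q y.coeff n := by
  have := congrArg (aeval (fun s : Fin 2 × ℕ => (![x.coeff, y.coeff] s.1) s.2))
    (ghost_addPoly A π q n)
  rw [map_ghost, map_add, map_ghost, map_ghost] at this
  simp only [aeval_X] at this
  exact this

theorem ghost_mul (x y : Witt A π q R) (n : ℕ) :
    ghost π q (x * y).coeff n = ghost π q x.coeff n * ghost π q y.coeff n := by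
  have := congrArg (aeval (fun s : Fin 2 × ℕ => (![x.coeff, y.coeff] s.1) s.2))
    (ghost_mulPoly A π q n)
  rw [map_ghost, map_mul, map_ghost, map_ghost] at this
  simp only [aeval_X] at this
  exact this

theorem ghost_neg (x : Witt A π q R) (n : ℕ) :
    ghost π q (-x).coeff n = -ghost π q x.coeff n := by
  have := congrArg (aeval x.coeff) (ghost_negPoly A π q n)
  rw [map_ghost, map_neg, map_ghost] at this
  simp only [aeval_X] at this
  exact this

theorem ghost_frobFun (x : Witt A π q R) (n : ℕ) :
    ghost π q (frobFun x).coeff n = ghost π q x.coeff (n + 1) := by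
  have := congrArg (aeval x.coeff) (ghost_frobPoly A π q n)
  rw [map_ghost, map_ghost] at this
  simp only [aeval_X] at this
  exact this

theorem ghost_const (a : A) (n : ℕ) :
    ghost π q (const A π q R a).coeff n = algebraMap A R a := by
  have := congrArg (Algebra.ofId A R) (ghost_constSeq A π q a n)
  rw [map_ghost] at this
  exact this

theorem ghost_ext {σ : Type*} {x y : Witt A π q (MvPolynomial σ A)}
    (h : ∀ n, ghost π q x.coeff n = ghost π q y.coeff n) : x = y :=
  Witt.ext (ghost_injective (poly_regular (π := π) (q := q)) h)

noncomputable instance instCommRing : CommRing (Witt A π q R) where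
  add_assoc x y z := by
    obtain ⟨x, rfl⟩ := exists_lift x
    obtain ⟨y, rfl⟩ := exists_lift y
    obtain ⟨z, rfl⟩ := exists_lift z
    simp only [← mapFun_add]
    exact congrArg _ (ghost_ext fun n => by simp only [ghost_add]; ring)
  zero_add x := by
    obtain ⟨x, rfl⟩ := exists_lift x
    rw [← mapFun_zero (aeval id), ← mapFun_add]
    exact congrArg _ (ghost_ext fun n => by simp only [ghost_add, ghost_zero']; ring)
  add_zero x := by
    obtain ⟨x, rfl⟩ := exists_lift x
    rw [← mapFun_zero (aeval id), ← mapFun_add]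
    exact congrArg _ (ghost_ext fun n => by simp only [ghost_add, ghost_zero']; ring)
  add_comm x y := by
    obtain ⟨x, rfl⟩ := exists_lift x
    obtain ⟨y, rfl⟩ := exists_lift y
    simp only [← mapFun_add]
    exact congrArg _ (ghost_ext fun n => by simp only [ghost_add]; ring)
  neg_add_cancel x := by
    obtain ⟨x, rfl⟩ := exists_lift x
    rw [← mapFun_zero (aeval id), ← mapFun_neg, ← mapFun_add]
    exact congrArg _ (ghost_ext fun n => by simp only [ghost_add, ghost_neg, ghost_zero']; ring)
  mul_assoc x y z := by
    obtain ⟨x, rfl⟩ := exists_lift x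
    obtain ⟨y, rfl⟩ := exists_lift y
    obtain ⟨z, rfl⟩ := exists_lift z
    simp only [← mapFun_mul]
    exact congrArg _ (ghost_ext fun n => by simp only [ghost_mul]; ring)
  mul_comm x y := by
    obtain ⟨x, rfl⟩ := exists_lift x
    obtain ⟨y, rfl⟩ := exists_lift y
    simp only [← mapFun_mul]
    exact congrArg _ (ghost_ext fun n => by simp only [ghost_mul]; ring)
  one_mul x := by
    obtain ⟨x, rfl⟩ := exists_lift x
    rw [← mapFun_one (aeval id), ← mapFun_mul]
    exact congrArg _ (ghost_ext fun n => by simp only [ghost_mul, ghost_one]; ring)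
  mul_one x := by
    obtain ⟨x, rfl⟩ := exists_lift x
    rw [← mapFun_one (aeval id), ← mapFun_mul]
    exact congrArg _ (ghost_ext fun n => by simp only [ghost_mul, ghost_one]; ring)
  zero_mul x := by
    obtain ⟨x, rfl⟩ := exists_lift x
    rw [← mapFun_zero (aeval id), ← mapFun_mul]
    exact congrArg _ (ghost_ext fun n => by simp only [ghost_mul, ghost_zero']; ring)
  mul_zero x := by
    obtain ⟨x, rfl⟩ := exists_lift x
    rw [← mapFun_zero (aeval id), ← mapFun_mul]
    exact congrArg _ (ghost_ext fun n => by simp only [ghost_mul, ghost_zero']; ring)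
  left_distrib x y z := by
    obtain ⟨x, rfl⟩ := exists_lift x
    obtain ⟨y, rfl⟩ := exists_lift y
    obtain ⟨z, rfl⟩ := exists_lift z
    simp only [← mapFun_mul, ← mapFun_add]
    exact congrArg _ (ghost_ext fun n => by simp only [ghost_mul, ghost_add]; ring)
  right_distrib x y z := by
    obtain ⟨x, rfl⟩ := exists_lift x
    obtain ⟨y, rfl⟩ := exists_lift y
    obtain ⟨z, rfl⟩ := exists_lift z
    simp only [← mapFun_mul, ← mapFun_add]
    exact congrArg _ (ghost_ext fun n => by simp only [ghost_mul, ghost_add]; ring)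
  nsmul := nsmulRec
  zsmul := zsmulRec

noncomputable instance instAlgebra : Algebra A (Witt A π q R) :=
  RingHom.toAlgebra
    { toFun := const A π q R
      map_one' := by
        rw [← mapFun_const (aeval (id : R → R)), ← mapFun_one (aeval id)]
        exact congrArg _ (ghost_ext fun n => by simp only [ghost_const, ghost_one, map_one])
      map_zero' := by
        rw [← mapFun_const (aeval (id : R → R)), ← mapFun_zero (aeval id)]
        exact congrArg _ (ghost_ext fun n => by simp only [ghost_const, ghost_zero', map_zero])
      map_add' := fun a b => by
        simp only [← mapFun_const (aeval (id : R → R)), ← mapFun_add]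
        exact congrArg _ (ghost_ext fun n => by simp only [ghost_const, ghost_add, map_add])
      map_mul' := fun a b => by
        simp only [← mapFun_const (aeval (id : R → R)), ← mapFun_mul]
        exact congrArg _ (ghost_ext fun n => by simp only [ghost_const, ghost_mul, map_mul]) }

theorem algebraMap_eq (a : A) : algebraMap A (Witt A π q R) a = const A π q R a := rfl

/-- The ghost map `W_π(R) → R^ℕ`, a homomorphism of `A`-algebras. -/
noncomputable def ghostMap : Witt A π q R →ₐ[A] (ℕ → R) where
  toFun x := ghost π q x.coeff
  map_one' := funext ghost_one
  map_mul' x y := funext (ghost_mul x y)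
  map_zero' := funext ghost_zero'
  map_add' x y := funext (ghost_add x y)
  commutes' a := funext (ghost_const a)

/-- Functoriality of `W_π`: apply an `A`-algebra homomorphism to each component. -/
noncomputable def map (f : R →ₐ[A] S) : Witt A π q R →ₐ[A] Witt A π q S where
  toFun := mapFun f
  map_one' := mapFun_one f
  map_mul' := mapFun_mul f
  map_zero' := mapFun_zero f
  map_add' := mapFun_add f
  commutes' := mapFun_const f

/-- The Frobenius of `W_π(R)`, which shifts ghost components by one. -/
noncomputable def frob : Witt A π q R →ₐ[A] Witt A π q R where
  toFun := frobFun
  map_one' := by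
    rw [← mapFun_one (aeval id), ← mapFun_frobFun]
    exact congrArg _ (ghost_ext fun n => by simp only [ghost_frobFun, ghost_one])
  map_mul' x y := by
    obtain ⟨x, rfl⟩ := exists_lift x
    obtain ⟨y, rfl⟩ := exists_lift y
    simp only [← mapFun_frobFun, ← mapFun_mul]
    exact congrArg _ (ghost_ext fun n => by simp only [ghost_frobFun, ghost_mul])
  map_zero' := by
    rw [← mapFun_zero (aeval id), ← mapFun_frobFun]
    exact congrArg _ (ghost_ext fun n => by simp only [ghost_frobFun, ghost_zero'])
  map_add' x y := by
    obtain ⟨x, rfl⟩ := exists_lift x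
    obtain ⟨y, rfl⟩ := exists_lift y
    simp only [← mapFun_frobFun, ← mapFun_add]
    exact congrArg _ (ghost_ext fun n => by simp only [ghost_frobFun, ghost_add])
  commutes' a := by
    rw [algebraMap_eq, ← mapFun_const (aeval (id : R → R)), ← mapFun_frobFun]
    exact congrArg _ (ghost_ext fun n => by simp only [ghost_frobFun, ghost_const])

theorem frob_map (f : R →ₐ[A] S) (x : Witt A π q R) : map f (frob x) = frob (map f x) :=
  mapFun_frobFun f x

theorem ghost_frob (x : Witt A π q R) (n : ℕ) :
    ghost π q (frob x).coeff n = ghost π q x.coeff (n + 1) := ghost_frobFun x n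

/-- If `π = 0` in `R`, the Frobenius raises each component to the `q`-th power. -/
theorem coeff_frob (h : algebraMap A R π = 0) (x : Witt A π q R) (n : ℕ) :
    (frob x).coeff n = x.coeff n ^ q := by
  have := map_dvd (aeval x.coeff) (frobPoly_dvd A π q n)
  rw [AlgHom.commutes, h, zero_dvd_iff, map_sub, map_pow, aeval_X, sub_eq_zero] at this
  exact this

/-- The zeroth component, a homomorphism of `A`-algebras. -/
noncomputable def coeffZero : Witt A π q R →ₐ[A] R :=
  { toFun := fun x => x.coeff 0
    map_one' := rfl
    map_zero' := rfl
    map_mul' := fun x y => by simpa [ghost_zero] using ghost_mul x y 0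
    map_add' := fun x y => by simpa [ghost_zero] using ghost_add x y 0
    commutes' := fun a => by
      rw [algebraMap_eq]
      simpa [ghost_zero] using ghost_const (R := R) (π := π) (q := q) a 0 }

/-- The inverse limit of `W_π(R) ← W_π(R) ← W_π(R) ← ⋯` along the Frobenius. -/
noncomputable def frobLimit (A : Type*) [CommRing A] (π : A) (q : ℕ) [Base A π q] (R : Type*)
    [CommRing R] [Algebra A R] : Subalgebra A (ℕ → Witt A π q R) where
  carrier := {x | ∀ i, frob (x (i + 1)) = x i}
  mul_mem' hx hy i := by simp [hx i, hy i]
  add_mem' hx hy i := by simp [hx i, hy i]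
  algebraMap_mem' a i := by simp [Pi.algebraMap_apply]

/-- Functoriality of the inverse limit along the Frobenius. -/
noncomputable def frobLimitMap (f : R →ₐ[A] S) : frobLimit A π q R →ₐ[A] frobLimit A π q S :=
  ((AlgHom.pi fun i => (map f).comp (Pi.evalAlgHom A (fun _ : ℕ => Witt A π q R) i)).comp
    (frobLimit A π q R).val).codRestrict _ fun x i =>
      show frob (map f (x.1 (i + 1))) = map f (x.1 i) by rw [← frob_map, x.2 i]

end ops

end Witt

/-! ### The local field `F` and the ring `𝓞_{ℂ_F}`

A finite extension `F` of `ℚ_p` is given with an embedding into `ℂ_p`. The algebraic closure of `ℚ_p` in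
`ℂ_p` is an algebraic closure of `F`, and `ℂ_p` is its completion; so `ℂ_F` is `ℂ_[p]` with this
embedding, and `𝓞_{ℂ_F}` is `𝓞_ℂ_[p]`. -/

section localField

variable (p : ℕ) [Fact p.Prime] (F : Type*) [Field F] [Algebra F ℂ_[p]]

/-- The ring of integers `𝓞_F` of `F`, the elements of absolute value at most `1`. -/
noncomputable abbrev IntF : ValuationSubring F := (PadicComplexInt p).comap (algebraMap F ℂ_[p])

/-- The residue field `k_F` of `F`. -/
abbrev ResF : Type _ := IsLocalRing.ResidueField (IntF p F)

/-- The cardinality `q` of the residue field of `F`. -/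
noncomputable abbrev cardRes : ℕ := Nat.card (ResF p F)

noncomputable instance : Algebra (IntF p F) 𝓞_ℂ_[p] :=
  RingHom.toAlgebra
    (((algebraMap F ℂ_[p]).comp (IntF p F).subtype).codRestrict (PadicComplexInt p).toSubring
      fun x => x.2)

theorem coe_algebraMap (x : IntF p F) :
    ((algebraMap (IntF p F) 𝓞_ℂ_[p] x : 𝓞_ℂ_[p]) : ℂ_[p]) = algebraMap F ℂ_[p] x := rfl

theorem mem_padicComplexInt (x : ℂ_[p]) : x ∈ 𝓞_ℂ_[p] ↔ ‖x‖ ≤ 1 := by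
  rw [PadicComplex.norm_eq_norm]
  exact (Valued.toNormedField.norm_le_one_iff (x := x)).symm

theorem norm_natCast_p : ‖(p : ℂ_[p])‖ = (p : ℝ)⁻¹ := by
  have := PadicComplex.norm_extends' p (p : ℚ_[p])
  rw [Padic.norm_p] at this
  rw [← this]
  norm_cast

variable {p F}

theorem norm_le_one (x : IntF p F) : ‖algebraMap F ℂ_[p] x‖ ≤ 1 :=
  (mem_padicComplexInt p _).1 x.2

theorem dvd_iff_norm_le (x y : IntF p F) :
    y ∣ x ↔ ‖algebraMap F ℂ_[p] x‖ ≤ ‖algebraMap F ℂ_[p] y‖ := by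
  constructor
  · rintro ⟨c, rfl⟩
    rw [show ((y * c : IntF p F) : F) = (y : F) * c from rfl, map_mul, norm_mul]
    exact mul_le_of_le_one_right (norm_nonneg _) (norm_le_one c)
  · intro h
    by_cases hy : (y : F) = 0
    · rw [hy, map_zero, norm_zero, norm_le_zero_iff, map_eq_zero] at h
      have : x = 0 := Subtype.ext h
      rw [this]; exact dvd_zero _
    · refine ⟨⟨x / y, ?_⟩, Subtype.ext ?_⟩
      · refine (mem_padicComplexInt p _).2 ?_
        rw [map_div₀, norm_div]
        exact div_le_one_of_le₀ h (norm_nonneg _)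
      · change (x : F) = y * (x / y)
        field_simp

theorem mem_maximalIdeal_iff (x : IntF p F) :
    x ∈ IsLocalRing.maximalIdeal (IntF p F) ↔ ‖algebraMap F ℂ_[p] x‖ < 1 := by
  rw [IsLocalRing.mem_maximalIdeal, mem_nonunits_iff, isUnit_iff_dvd_one, dvd_iff_norm_le, not_le]
  simp

theorem natCast_mem_maximalIdeal :
    (p : IntF p F) ∈ IsLocalRing.maximalIdeal (IntF p F) := by
  rw [mem_maximalIdeal_iff]
  have : algebraMap F ℂ_[p] ((p : IntF p F) : F) = p := by simp
  rw [this, norm_natCast_p]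
  exact inv_lt_one_of_one_lt₀ (by exact_mod_cast (Fact.out : p.Prime).one_lt)

theorem natCast_ne_zero : (p : IntF p F) ≠ 0 := by
  intro h
  have : algebraMap F ℂ_[p] ((p : IntF p F) : F) = p := by simp
  rw [h] at this
  simp at this
  exact (Fact.out : p.Prime).ne_zero (by exact_mod_cast this.symm)

theorem natCast_p_dvd_iff (x : IntF p F) (n : ℕ) :
    (p : IntF p F) ^ n ∣ x ↔ ‖algebraMap F ℂ_[p] x‖ ≤ ((p : ℝ)⁻¹) ^ n := by
  rw [dvd_iff_norm_le, ← norm_natCast_p, ← norm_pow]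
  simp

instance : Fact ¬IsUnit (p : IntF p F) :=
  ⟨(IsLocalRing.mem_maximalIdeal _).1 natCast_mem_maximalIdeal⟩

instance : Fact ¬IsUnit (p : 𝓞_ℂ_[p]) := ⟨by
  rintro ⟨u, hu⟩
  have h1 : (u : 𝓞_ℂ_[p]) * (u⁻¹ : (𝓞_ℂ_[p])ˣ) = 1 := u.mul_inv
  rw [hu] at h1
  have h2 : (p : ℂ_[p]) * (((u⁻¹ : (𝓞_ℂ_[p])ˣ) : 𝓞_ℂ_[p]) : ℂ_[p]) = 1 := by
    simpa using congrArg (Subtype.val) h1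
  have h3 := congrArg norm h2
  rw [norm_mul, norm_natCast_p, norm_one] at h3
  have h4 := (mem_padicComplexInt p _).1 ((u⁻¹ : (𝓞_ℂ_[p])ˣ) : 𝓞_ℂ_[p]).2
  have h5 : (p : ℝ)⁻¹ < 1 :=
    inv_lt_one_of_one_lt₀ (by exact_mod_cast (Fact.out : p.Prime).one_lt)
  have h6 : (0 : ℝ) ≤ (p : ℝ)⁻¹ := by positivity
  nlinarith [norm_nonneg (((u⁻¹ : (𝓞_ℂ_[p])ˣ) : 𝓞_ℂ_[p]) : ℂ_[p])]⟩

instance : CharP (ResF p F) p := by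
  have h : ((p : ℕ) : ResF p F) = 0 := by
    rw [← map_natCast (IsLocalRing.residue (IntF p F)), IsLocalRing.residue_eq_zero_iff]
    exact natCast_mem_maximalIdeal
  exact (CharP.charP_iff_prime_eq_zero Fact.out).2 h

section uniformizer

variable (π : IntF p F) [hπ : Fact (Ideal.span {π} = IsLocalRing.maximalIdeal (IntF p F))]

theorem algebraMap_dvd_p : algebraMap (IntF p F) 𝓞_ℂ_[p] π ∣ (p : 𝓞_ℂ_[p]) := by
  have h : π ∣ (p : IntF p F) := by
    rw [← Ideal.mem_span_singleton, hπ.out]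
    exact natCast_mem_maximalIdeal
  simpa using map_dvd (algebraMap (IntF p F) 𝓞_ℂ_[p]) h

theorem exists_p_dvd_pow : ∃ M, (p : 𝓞_ℂ_[p]) ∣ algebraMap (IntF p F) 𝓞_ℂ_[p] π ^ M := by
  have hd : ‖algebraMap F ℂ_[p] π‖ < 1 := by
    rw [← mem_maximalIdeal_iff, ← hπ.out]
    exact Ideal.mem_span_singleton_self _
  have h2 : (0 : ℝ) < (p : ℝ)⁻¹ := by
    have := (Fact.out : p.Prime).pos
    positivity
  obtain ⟨M, hM⟩ := exists_pow_lt_of_lt_one h2 hd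
  refine ⟨M, ?_⟩
  have h3 := (natCast_p_dvd_iff (p := p) (F := F) (π ^ M) 1).2 (by
      rw [pow_one]; simpa using hM.le)
  simpa using map_dvd (algebraMap (IntF p F) 𝓞_ℂ_[p]) h3

end uniformizer

variable [Algebra ℚ_[p] F] [FiniteDimensional ℚ_[p] F] [IsScalarTower ℚ_[p] F ℂ_[p]]

variable (p F) in
/-- The image of `F` in `ℂ_p`. -/
noncomputable def rangeF : Submodule ℚ_[p] ℂ_[p] :=
  LinearMap.range (IsScalarTower.toAlgHom ℚ_[p] F ℂ_[p]).toLinearMap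

instance : FiniteDimensional ℚ_[p] (rangeF p F) := by
  unfold rangeF; infer_instance

theorem isClosed_rangeF : IsClosed (rangeF p F : Set ℂ_[p]) :=
  Submodule.closed_of_finiteDimensional _

instance : Finite (ResF p F) := by
  have hP : ProperSpace (rangeF p F) := FiniteDimensional.proper ℚ_[p] _
  obtain ⟨t, -, htf, ht⟩ := finite_cover_balls_of_compact
    (isCompact_closedBall (0 : rangeF p F) 1) one_pos
  let g : IntF p F → rangeF p F := fun x => ⟨algebraMap F ℂ_[p] x, ⟨(x : F), rfl⟩⟩
  have hg : ∀ x, ∃ c ∈ t, dist (g x) c < 1 := by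
    intro x
    have := ht (show g x ∈ Metric.closedBall 0 1 by
      rw [mem_closedBall_zero_iff]; exact norm_le_one x)
    simpa using this
  choose c hct hc using hg
  have := htf.to_subtype
  choose s hs using IsLocalRing.residue_surjective (R := IntF p F)
  refine Finite.of_injective (β := t) (fun a => ⟨c (s a), hct _⟩) fun a b hab => ?_
  have hab : c (s a) = c (s b) := congrArg Subtype.val hab
  rw [← hs a, ← hs b, ← sub_eq_zero, ← map_sub, IsLocalRing.residue_eq_zero_iff,
    mem_maximalIdeal_iff]
  have h1 := hc (s a)
  have h2 := hc (s b)
  rw [hab] at h1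
  rw [dist_comm] at h2
  have h1' : ‖((g (s a) : ℂ_[p]) - (c (s b) : ℂ_[p]))‖ < 1 := by
    rw [← dist_eq_norm]; exact h1
  have h2' : ‖((c (s b) : ℂ_[p]) - (g (s b) : ℂ_[p]))‖ < 1 := by
    rw [← dist_eq_norm]; exact h2
  have h3 := (PadicComplex.isNonarchimedean p) ((g (s a) : ℂ_[p]) - (c (s b) : ℂ_[p]))
    ((c (s b) : ℂ_[p]) - (g (s b) : ℂ_[p]))
  rw [sub_add_sub_cancel] at h3
  have h4 : algebraMap F ℂ_[p] ((s a - s b : IntF p F) : F) = (g (s a) : ℂ_[p]) - g (s b) := by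
    change algebraMap F ℂ_[p] ((s a : F) - s b) = _
    rw [map_sub]
  rw [h4]
  exact h3.trans_lt (max_lt h1' h2')

theorem cardRes_eq : ∃ f, 0 < f ∧ cardRes p F = p ^ f := by
  have := Fintype.ofFinite (ResF p F)
  obtain ⟨n, -, h⟩ := FiniteField.card (ResF p F) p
  exact ⟨n, n.pos, by rw [cardRes, Nat.card_eq_fintype_card, h]⟩

theorem residue_pow_cardRes (a : ResF p F) : a ^ cardRes p F = a := by
  have := Fintype.ofFinite (ResF p F)
  rw [cardRes, Nat.card_eq_fintype_card, FiniteField.pow_card]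

/-- `𝓞_F` is `p`-adically complete and separated. -/
instance : IsAdicComplete (Ideal.span {(p : IntF p F)}) (IntF p F) where
  haus' x hx := by
    have h : ∀ n : ℕ, ‖algebraMap F ℂ_[p] x‖ ≤ ((p : ℝ)⁻¹) ^ n := fun n => by
      have := hx n
      rw [SModEq.zero, smul_eq_mul, Ideal.mul_top, Ideal.span_singleton_pow,
        Ideal.mem_span_singleton] at this
      exact (natCast_p_dvd_iff x n).1 this
    have h5 : (p : ℝ)⁻¹ < 1 :=
      inv_lt_one_of_one_lt₀ (by exact_mod_cast (Fact.out : p.Prime).one_lt)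
    have := ge_of_tendsto' (tendsto_pow_atTop_nhds_zero_of_lt_one (by positivity) h5) h
    rw [norm_le_zero_iff, map_eq_zero] at this
    exact Subtype.ext this
  prec' f hf := by
    have hf' : ∀ m n, m ≤ n →
        ‖algebraMap F ℂ_[p] (f m) - algebraMap F ℂ_[p] (f n)‖ ≤ ((p : ℝ)⁻¹) ^ m := by
      intro m n hmn
      have := hf hmn
      rw [SModEq.sub_mem, smul_eq_mul, Ideal.mul_top, Ideal.span_singleton_pow,
        Ideal.mem_span_singleton, natCast_p_dvd_iff] at this
      rw [← map_sub]
      exact this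
    have h5 : (p : ℝ)⁻¹ < 1 :=
      inv_lt_one_of_one_lt₀ (by exact_mod_cast (Fact.out : p.Prime).one_lt)
    have h6 := tendsto_pow_atTop_nhds_zero_of_lt_one (show (0 : ℝ) ≤ (p : ℝ)⁻¹ by positivity) h5
    have hc : CauchySeq fun n => algebraMap F ℂ_[p] (f n) := by
      refine cauchySeq_of_le_tendsto_0' (fun n => ((p : ℝ)⁻¹) ^ n) (fun m n hmn => ?_) h6
      rw [dist_eq_norm]; exact hf' m n hmn
    obtain ⟨L, hL⟩ := cauchySeq_tendsto_of_complete hc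
    have hmem : L ∈ (rangeF p F : Set ℂ_[p]) :=
      isClosed_rangeF.mem_of_tendsto hL (Filter.Eventually.of_forall fun n => ⟨(f n : F), rfl⟩)
    obtain ⟨y, hy⟩ := hmem
    have hy : algebraMap F ℂ_[p] y = L := hy
    have hLn : ‖L‖ ≤ 1 := le_of_tendsto' hL.norm fun n => norm_le_one (f n)
    refine ⟨⟨y, (mem_padicComplexInt p _).2 (by rw [hy]; exact hLn)⟩, fun n => ?_⟩
    rw [SModEq.sub_mem, smul_eq_mul, Ideal.mul_top, Ideal.span_singleton_pow,
        Ideal.mem_span_singleton, natCast_p_dvd_iff]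
    change ‖algebraMap F ℂ_[p] ((f n : F) - y)‖ ≤ _
    rw [map_sub, hy]
    refine le_of_tendsto ((tendsto_const_nhds.sub hL).norm) ?_
    filter_upwards [Filter.eventually_ge_atTop n] with m hm using hf' n m hm

end localField

open Filter
open scoped TensorProduct Topology

/-! ### The inverse limit of `O/(π)` along `x ↦ x^q` -/

section powLimit

variable {A : Type*} [CommRing A] (π : A) (q : ℕ) (O : Type*) [CommRing O] [Algebra A O]

/-- The quotient `O/(π)`. -/
abbrev ModPi : Type _ := O ⧸ Ideal.span {algebraMap A O π}

theorem algebraMap_modPi : algebraMap A (ModPi π O) π = 0 := by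
  rw [IsScalarTower.algebraMap_apply A O (ModPi π O)]
  exact Ideal.Quotient.eq_zero_iff_mem.2 (Ideal.mem_span_singleton_self _)

variable [Base A π q]

/-- The ring `lim_{x ↦ x^q} O/(π)`, an `A`-algebra through constant sequences. -/
def powLimit : Subalgebra A (ℕ → ModPi π O) where
  carrier := {x | ∀ i, x (i + 1) ^ q = x i}
  mul_mem' hx hy i := by
    simp only [Pi.mul_apply]; rw [mul_pow, hx i, hy i]
  add_mem' {x y} hx hy i := by
    have := dvd_add_pow (A := A) (π := π) (q := q) (x (i + 1)) (y (i + 1))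
    rw [algebraMap_modPi, zero_dvd_iff, sub_eq_zero] at this
    simp only [Pi.add_apply]; rw [this, hx i, hy i]
  algebraMap_mem' a i := by
    have := map_dvd (algebraMap A (ModPi π O)) (Base.dvd_pow_sub (π := π) (q := q) a)
    rw [algebraMap_modPi, zero_dvd_iff, map_sub, map_pow, sub_eq_zero] at this
    exact this

theorem algebraMap_powLimit : algebraMap A (powLimit π q O) π = 0 :=
  Subtype.ext (funext fun _ => algebraMap_modPi π O)

variable {O π q} in
theorem powLimit_pow (x : powLimit π q O) (i j : ℕ) : x.1 (i + j) ^ q ^ j = x.1 i := by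
  induction j with
  | zero => simp
  | succ j ih => rw [pow_succ', pow_mul, ← add_assoc, x.2 (i + j), ih]

/-- The `i`-th projection from `lim_{x ↦ x^q} O/(π)`. -/
noncomputable def powLimitProj (i : ℕ) : powLimit π q O →ₐ[A] ModPi π O :=
  (Pi.evalAlgHom A (fun _ : ℕ => ModPi π O) i).comp (powLimit π q O).val

theorem witt_powLimit_ext {x y : Witt A π q (powLimit π q O)}
    (h : ∀ i, Witt.map (powLimitProj π q O i) x = Witt.map (powLimitProj π q O i) y) : x = y := by
  refine Witt.ext (funext fun n => Subtype.ext (funext fun i => ?_))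
  exact congrFun (congrArg Witt.coeff (h i)) n

variable {π q O} in
/-- The underlying function of `permute`. -/
noncomputable def permuteFun (x : Witt.frobLimit A π q (ModPi π O)) : Witt A π q (powLimit π q O) :=
  ⟨fun i => ⟨fun j => (x.1 j).coeff i, fun j => by
    rw [← Witt.coeff_frob (algebraMap_modPi π O), x.2 j]⟩⟩

theorem map_permuteFun (x : Witt.frobLimit A π q (ModPi π O)) (j : ℕ) :
    Witt.map (powLimitProj π q O j) (permuteFun x) = x.1 j := rfl

/-- The map `lim_Fr W_π(O/(π)) → W_π(lim_{x ↦ x^q} O/(π))` permuting the indices: the `j`-th term of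
the inverse system giving the `i`-th Witt component of the image of `x` is the `i`-th Witt component
of the `j`-th term of `x`. -/
noncomputable def permute :
    Witt.frobLimit A π q (ModPi π O) →ₐ[A] Witt A π q (powLimit π q O) where
  toFun x := permuteFun x
  map_one' := witt_powLimit_ext π q O fun i => by rw [map_one, map_permuteFun]; rfl
  map_zero' := witt_powLimit_ext π q O fun i => by rw [map_zero, map_permuteFun]; rfl
  map_mul' x y := witt_powLimit_ext π q O fun i => by
    rw [map_mul, map_permuteFun, map_permuteFun, map_permuteFun]; rfl
  map_add' x y := witt_powLimit_ext π q O fun i => by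
    rw [map_add, map_permuteFun, map_permuteFun, map_permuteFun]; rfl
  commutes' a := witt_powLimit_ext π q O fun i => by
    rw [AlgHom.commutes, map_permuteFun]; rfl

/-- The map `lim_Fr W_π(O) → lim_Fr W_π(O/(π))` induced by reduction modulo `π`. -/
noncomputable def reduce : Witt.frobLimit A π q O →ₐ[A] Witt.frobLimit A π q (ModPi π O) :=
  Witt.frobLimitMap (Ideal.Quotient.mkₐ A _)

end powLimit

/-! ### Comparison of `lim_{x ↦ x^p} O/(p)` and `lim_{x ↦ x^q} O/(π)` -/

section tilt

variable {A : Type*} [CommRing A] (π : A) (q : ℕ) (O : Type*) [CommRing O] [Algebra A O]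
  [Base A π q] (p : ℕ) [Fact p.Prime] [Fact ¬IsUnit (p : O)]

variable {π O p} in
/-- The reduction map `O/(p) → O/(π)`, for `π ∣ p`. -/
noncomputable def modPToModPi (hp : algebraMap A O π ∣ (p : O)) : ModP O p →+* ModPi π O :=
  Ideal.Quotient.factor (Ideal.span_singleton_le_span_singleton.2 hp)

/-- The map `lim_{x ↦ x^p} O/(p) → lim_{x ↦ x^q} O/(π)`, for `q = p^f` and `π ∣ p`, which sends
`(x_0, x_1, x_2, …)` to `(x_0 mod π, x_f mod π, x_{2f} mod π, …)`. -/
noncomputable def tiltHom (hq : q = p ^ Nat.log p q) (hp : algebraMap A O π ∣ (p : O)) :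
    PreTilt O p →+* powLimit π q O :=
  (RingHom.pi fun n => (modPToModPi hp).comp
    (PreTilt.coeff (Nat.log p q * n))).codRestrict (powLimit π q O).toSubring fun x n => by
    change modPToModPi hp (PreTilt.coeff (Nat.log p q * (n + 1)) x) ^ q =
      modPToModPi hp (PreTilt.coeff (Nat.log p q * n) x)
    rw [← map_pow]
    congr 1
    conv_lhs => arg 2; rw [hq]
    rw [mul_add, mul_one, ← map_pow, ← iterate_frobenius]
    exact PreTilt.coeff_iterate_frobenius _ _ _

variable {q O p}

theorem pow_p_pow_congr {M : ℕ} (hM : (p : O) ∣ algebraMap A O π ^ M) {k : ℕ} (hk : M ≤ k)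
    {a b : O} (h : algebraMap A O π ∣ a - b) :
    (Ideal.Quotient.mk (Ideal.span {(p : O)}) a : ModP O p) ^ p ^ k =
      Ideal.Quotient.mk (Ideal.span {(p : O)}) b ^ p ^ k := by
  rw [← sub_eq_zero, ← sub_pow_char_pow, ← map_sub, ← map_pow, Ideal.Quotient.eq_zero_iff_mem,
    Ideal.mem_span_singleton]
  refine hM.trans ((pow_dvd_pow _ ?_).trans (pow_dvd_pow_of_dvd h _))
  exact hk.trans (Nat.lt_pow_self (Fact.out : p.Prime).one_lt).le

theorem tiltHom_bijective (hq : q = p ^ Nat.log p q) (hp : algebraMap A O π ∣ (p : O))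
    {M : ℕ} (hM : (p : O) ∣ algebraMap A O π ^ M) :
    Function.Bijective (tiltHom π q O p hq hp) := by
  have hf : 0 < Nat.log p q := by
    rcases Nat.eq_zero_or_pos (Nat.log p q) with h | h
    · have := one_lt (A := A) (π := π) (q := q)
      rw [h, pow_zero] at hq; omega
    · exact h
  set f := Nat.log p q with hfdef
  constructor
  · rw [injective_iff_map_eq_zero]
    intro x hx
    have h0 : ∀ n, modPToModPi hp (PreTilt.coeff (f * n) x) = 0 := fun n =>
      congrFun (congrArg Subtype.val hx) n
    refine Perfection.ext fun m => ?_
    change PreTilt.coeff m x = 0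
    obtain ⟨k, hk⟩ : ∃ k, f * (m + M) = m + k ∧ M ≤ k :=
      ⟨f * (m + M) - m, by
        have : m + M ≤ f * (m + M) := Nat.le_mul_of_pos_left _ hf
        omega⟩
    have h1 := PreTilt.coeff_iterate_frobenius m k x
    rw [← h1, iterate_frobenius, map_pow, ← hk.1]
    obtain ⟨y, hy⟩ := Ideal.Quotient.mk_surjective (PreTilt.coeff (f * (m + M)) x)
    have h2 := h0 (m + M)
    rw [← hy, modPToModPi, Ideal.Quotient.factor_mk, Ideal.Quotient.eq_zero_iff_mem,
      Ideal.mem_span_singleton] at h2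
    rw [← hy, pow_p_pow_congr π hM hk.2 (b := 0) (by simpa using h2), map_zero]
    exact zero_pow (pow_ne_zero _ (Fact.out : p.Prime).ne_zero)
  · intro y
    choose l hl using fun n => Ideal.Quotient.mk_surjective (y.1 n)
    have hstep : ∀ n, algebraMap A O π ∣ l (n + 1) ^ q - l n := by
      intro n
      rw [← Ideal.mem_span_singleton, ← Ideal.Quotient.eq_zero_iff_mem, map_sub, map_pow, hl, hl,
        y.2 n, sub_self]
    have hle : ∀ m, M ≤ f * (m + M) - m := fun m => by
      have : m + M ≤ f * (m + M) := Nat.le_mul_of_pos_left _ hf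
      omega
    let x : PreTilt O p := ⟨fun m => Ideal.Quotient.mk (Ideal.span {(p : O)})
      (l (m + M)) ^ p ^ (f * (m + M) - m), fun m => by
        beta_reduce
        have e := pow_p_pow_congr π hM (hle m) (hstep (m + M))
        rw [← e, ← pow_mul, ← pow_succ, map_pow]
        conv_rhs => arg 1; arg 2; rw [hq]
        rw [← pow_mul, ← pow_add]
        have h1 : m + 1 + M = m + M + 1 := by omega
        have h2 : f * (m + M + 1) - (m + 1) + 1 = f + (f * (m + M) - m) := by
          have : m + M ≤ f * (m + M) := Nat.le_mul_of_pos_left _ hf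
          rw [mul_add f (m + M) 1]
          omega
        rw [h1, h2]⟩
    refine ⟨x, Subtype.ext (funext fun n => ?_)⟩
    change modPToModPi hp (Ideal.Quotient.mk (Ideal.span {(p : O)})
      (l (f * n + M)) ^ p ^ (f * (f * n + M) - f * n)) = y.1 n
    rw [map_pow, modPToModPi, Ideal.Quotient.factor_mk, hl]
    obtain ⟨j, hj⟩ : ∃ j, f * n + M = n + j :=
      ⟨f * n + M - n, by
        have : n ≤ f * n := Nat.le_mul_of_pos_left _ hf
        omega⟩
    have h3 : f * (f * n + M) - f * n = f * j := by
      rw [hj, mul_add]; omega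
    rw [h3, pow_mul, ← hq, hj, powLimit_pow]

end tilt

/-! ### The rings of the comparison -/

section localField

variable (p : ℕ) [Fact p.Prime] (F : Type*) [Field F] [Algebra ℚ_[p] F] [FiniteDimensional ℚ_[p] F]
  [Algebra F ℂ_[p]] [IsScalarTower ℚ_[p] F ℂ_[p]]

theorem cardRes_eq_pow_log : cardRes p F = p ^ Nat.log p (cardRes p F) := by
  obtain ⟨f, -, h⟩ := cardRes_eq (p := p) (F := F)
  rw [h, Nat.log_pow (Fact.out : p.Prime).one_lt]

theorem exists_resToModP : ∃ g : ResF p F →+* ModP (IntF p F) p,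
    ∀ c, ∃ a : IntF p F, g c = Ideal.Quotient.mk _ a ∧ IsLocalRing.residue (IntF p F) a = c := by
  choose s hs using IsLocalRing.residue_surjective (R := IntF p F)
  have hlim : ∀ d : IntF p F, IsLocalRing.residue (IntF p F) d = 0 →
      ∀ᶠ k in Filter.atTop, (p : IntF p F) ∣ d ^ k := by
    intro d hd
    rw [IsLocalRing.residue_eq_zero_iff, mem_maximalIdeal_iff] at hd
    have h1 := tendsto_pow_atTop_nhds_zero_of_lt_one (norm_nonneg _) hd
    have h2 : (0 : ℝ) < (p : ℝ)⁻¹ := by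
      have := (Fact.out : p.Prime).pos
      positivity
    filter_upwards [h1.eventually (ge_mem_nhds h2)] with k hk
    have := (natCast_p_dvd_iff (p := p) (F := F) (d ^ k) 1).2 (by
      rw [pow_one]; simpa using hk)
    simpa using this
  have hmul : ∀ᶠ k in Filter.atTop, ∀ c d, (p : IntF p F) ∣ (s (c * d) - s c * s d) ^ k :=
    Filter.eventually_all.2 fun c => Filter.eventually_all.2 fun d =>
      hlim _ (by simp [map_sub, hs])
  have hadd : ∀ᶠ k in Filter.atTop, ∀ c d, (p : IntF p F) ∣ (s (c + d) - (s c + s d)) ^ k :=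
    Filter.eventually_all.2 fun c => Filter.eventually_all.2 fun d =>
      hlim _ (by simp [map_sub, hs])
  have hone : ∀ᶠ k in Filter.atTop, (p : IntF p F) ∣ (s 1 - 1) ^ k :=
    hlim _ (by simp [map_sub, hs])
  have hzero : ∀ᶠ k in Filter.atTop, (p : IntF p F) ∣ (s 0 - 0) ^ k :=
    hlim _ (by simp [hs])
  obtain ⟨f, hf0, hf⟩ := cardRes_eq (p := p) (F := F)
  have hq1 : 1 < cardRes p F := by
    rw [hf]; exact Nat.one_lt_pow hf0.ne' (Fact.out : p.Prime).one_lt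
  obtain ⟨N, ⟨⟨hmul, hadd⟩, hone⟩, hzero⟩ :=
    ((tendsto_pow_atTop_atTop_of_one_lt hq1).eventually
      (((hmul.and hadd).and hone).and hzero)).exists
  have key : ∀ a b : IntF p F, (p : IntF p F) ∣ (a - b) ^ cardRes p F ^ N →
      (Ideal.Quotient.mk (Ideal.span {(p : IntF p F)}) a : ModP (IntF p F) p) ^ cardRes p F ^ N =
      Ideal.Quotient.mk (Ideal.span {(p : IntF p F)}) b ^ cardRes p F ^ N := by
    intro a b h
    rw [← Ideal.mem_span_singleton, ← Ideal.Quotient.eq_zero_iff_mem, map_pow, map_sub, hf,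
      ← pow_mul, sub_pow_char_pow, sub_eq_zero] at h
    rw [hf, ← pow_mul]
    exact h
  refine ⟨{ toFun := fun c => Ideal.Quotient.mk (Ideal.span {(p : IntF p F)}) (s c) ^
              cardRes p F ^ N
            map_one' := by rw [key _ _ hone, map_one, one_pow]
            map_zero' := by
              rw [key _ _ hzero, map_zero, zero_pow (pow_ne_zero _ (by omega))]
            map_mul' := fun c d => by rw [key _ _ (hmul c d), map_mul, mul_pow]
            map_add' := fun c d => by
              rw [key _ _ (hadd c d), map_add, hf, ← pow_mul, add_pow_char_pow] },
    fun c => ⟨s c ^ cardRes p F ^ N, (map_pow _ _ _).symm, ?_⟩⟩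
  rw [map_pow, hs]
  clear hmul hadd hone hzero key
  induction N with
  | zero => simp
  | succ N ih => rw [pow_succ, pow_mul, ih, residue_pow_cardRes]

/-- The ring homomorphism `k_F → 𝓞_F/(p)` that is a section of the reduction map. -/
noncomputable def resToModP : ResF p F →+* ModP (IntF p F) p :=
  (exists_resToModP p F).choose

noncomputable instance : PerfectRing (ResF p F) p := PerfectRing.ofFiniteOfIsReduced p _

/-- The ring homomorphism `k_F → lim_{x ↦ x^p} 𝓞_F/(p)` induced by `resToModP` (`k_F` is perfect). -/
noncomputable def resToTilt : ResF p F →+* PreTilt (IntF p F) p :=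
  Perfection.lift p (ResF p F) (ModP (IntF p F) p) (resToModP p F)

theorem resToTilt_coeff_zero (c : ResF p F) :
    PreTilt.coeff 0 (resToTilt p F c) = resToModP p F c :=
  RingHom.congr_fun ((Perfection.lift p (ResF p F) (ModP (IntF p F) p)).symm_apply_apply
    (resToModP p F)) c

/-- `𝓞_F` is an algebra over `W(k_F)`, through the homomorphism that lifts the identity of `k_F`. -/
noncomputable instance : Algebra (WittVector p (ResF p F)) (IntF p F) :=
  RingHom.toAlgebra
    ((WittVector.fontaineTheta (IntF p F) p).comp (WittVector.map (resToTilt p F)))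

/-- The homomorphism `W(k_F) → 𝓞_F` lifts the identity of the residue field `k_F`. -/
theorem residue_algebraMap_witt (w : WittVector p (ResF p F)) :
    IsLocalRing.residue (IntF p F) (algebraMap (WittVector p (ResF p F)) (IntF p F) w) =
      w.coeff 0 := by
  have h1 := WittVector.mk_fontaineTheta (R := IntF p F) (p := p)
    (WittVector.map (resToTilt p F) w)
  rw [WittVector.map_coeff, resToTilt_coeff_zero] at h1
  obtain ⟨a, ha, ha'⟩ := (exists_resToModP p F).choose_spec (w.coeff 0)
  rw [show resToModP p F (w.coeff 0) = _ from ha, Ideal.Quotient.eq,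
    Ideal.mem_span_singleton] at h1
  rw [← ha', ← sub_eq_zero, ← map_sub, IsLocalRing.residue_eq_zero_iff]
  exact Ideal.mem_of_dvd _ h1 natCast_mem_maximalIdeal

/-- The ring `Ẽ⁺ = lim_{x ↦ x^p} 𝓞_{ℂ_F}/(p)`. -/
abbrev EPlus : Type := PreTilt 𝓞_ℂ_[p] p

/-- The map `𝓞_F/(p) → 𝓞_{ℂ_F}/(p)`. -/
noncomputable def modPMap : ModP (IntF p F) p →+* ModP 𝓞_ℂ_[p] p :=
  Ideal.quotientMap _ (algebraMap (IntF p F) 𝓞_ℂ_[p]) (by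
    rw [Ideal.span_singleton_le_iff_mem, Ideal.mem_comap, map_natCast]
    exact Ideal.mem_span_singleton_self _)

/-- `Ẽ⁺` is a `k_F`-algebra, by
`k_F → lim_{x ↦ x^p} 𝓞_F/(p) → lim_{x ↦ x^p} 𝓞_{ℂ_F}/(p)`. -/
noncomputable instance : Algebra (ResF p F) (EPlus p) :=
  RingHom.toAlgebra (RingHom.comp
    (Perfection.map p (modPMap p F) : PreTilt (IntF p F) p →+* PreTilt 𝓞_ℂ_[p] p)
    (resToTilt p F))

/-- `W(E)` is a `W(k_F)`-algebra if `E` is a `k_F`-algebra. -/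
noncomputable instance (E : Type*) [CommRing E] [Algebra (ResF p F) E] :
    Algebra (WittVector p (ResF p F)) (WittVector p E) :=
  RingHom.toAlgebra (WittVector.map (algebraMap (ResF p F) E))

/-- The ring `W(E) ⊗_{W(k_F)} 𝓞_F` for a `k_F`-algebra `E`, where `W` denotes the usual `p`-typical
Witt vectors. -/
abbrev WittTensor (E : Type*) [CommRing E] [Algebra (ResF p F) E] : Type _ :=
  WittVector p E ⊗[WittVector p (ResF p F)] IntF p F

noncomputable instance (E : Type*) [CommRing E] [Algebra (ResF p F) E] :
    Algebra (IntF p F) (WittTensor p F E) :=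
  Algebra.TensorProduct.rightAlgebra

variable {p F}
variable (π : IntF p F) [hπ : Fact (Ideal.span {π} = IsLocalRing.maximalIdeal (IntF p F))]

instance : Base (IntF p F) π (cardRes p F) where
  regular a h := by
    rcases mul_eq_zero.1 h with h0 | h0
    · have h1 := hπ.out
      have h2 := natCast_mem_maximalIdeal (p := p) (F := F)
      rw [← h1, h0, Ideal.mem_span_singleton, zero_dvd_iff] at h2
      exact absurd h2 natCast_ne_zero
    · exact h0
  dvd_pow_sub a := by
    rw [← Ideal.mem_span_singleton, hπ.out, ← IsLocalRing.residue_eq_zero_iff, map_sub, map_pow,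
      residue_pow_cardRes, sub_self]
  exists_prime := by
    obtain ⟨f, hf, h⟩ := cardRes_eq (p := p) (F := F)
    refine ⟨p, f, Fact.out, hf, h, ?_⟩
    rw [← Ideal.mem_span_singleton, hπ.out]
    exact natCast_mem_maximalIdeal

/-- The ring `lim_{x ↦ x^q} 𝓞_{ℂ_F}/(π)`. -/
abbrev EPlusQ : Type := powLimit π (cardRes p F) 𝓞_ℂ_[p]

/-- `lim_{x ↦ x^q} 𝓞_{ℂ_F}/(π)` is an algebra over `k_F = 𝓞_F/(π)`, through constant sequences. -/
noncomputable instance : Algebra (ResF p F) (EPlusQ π) :=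
  RingHom.toAlgebra (Ideal.Quotient.lift (IsLocalRing.maximalIdeal (IntF p F))
    (algebraMap (IntF p F) (EPlusQ π)) fun a ha => by
      rw [← hπ.out, Ideal.mem_span_singleton] at ha
      obtain ⟨b, rfl⟩ := ha
      rw [map_mul, algebraMap_powLimit, zero_mul])

theorem algebraMap_residue (a : IntF p F) :
    algebraMap (ResF p F) (EPlusQ π) (IsLocalRing.residue (IntF p F) a) =
      algebraMap (IntF p F) (EPlusQ π) a := rfl

/-- The isomorphism `Ẽ⁺ = lim_{x ↦ x^p} 𝓞_{ℂ_F}/(p) ≅ lim_{x ↦ x^q} 𝓞_{ℂ_F}/(π)`. -/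
noncomputable def tiltEquiv : EPlus p ≃ₐ[ResF p F] EPlusQ π :=
  AlgEquiv.ofRingEquiv
    (f := RingEquiv.ofBijective
      (tiltHom π (cardRes p F) 𝓞_ℂ_[p] p (cardRes_eq_pow_log p F) (algebraMap_dvd_p π))
      (tiltHom_bijective π _ _ (exists_p_dvd_pow π).choose_spec)) (by
    intro c
    refine Subtype.ext (funext fun n => ?_)
    have h1 : PreTilt.coeff (Nat.log p (cardRes p F) * n) (resToTilt p F c) =
        resToModP p F c := by
      have hc : c = c ^ p ^ (Nat.log p (cardRes p F) * n) := by
        rw [pow_mul, ← cardRes_eq_pow_log]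
        induction n with
        | zero => simp
        | succ n ih => rw [pow_succ, pow_mul, ← ih, residue_pow_cardRes]
      conv_lhs => rw [hc]
      rw [map_pow, ← iterate_frobenius, ← resToTilt_coeff_zero]
      have := PreTilt.coeff_iterate_frobenius 0 (Nat.log p (cardRes p F) * n) (resToTilt p F c)
      rwa [zero_add] at this
    obtain ⟨a, ha, ha'⟩ := (exists_resToModP p F).choose_spec c
    change modPToModPi (algebraMap_dvd_p π) (modPMap p F
      (PreTilt.coeff (Nat.log p (cardRes p F) * n) (resToTilt p F c))) = _
    rw [h1, show resToModP p F c = _ from ha, ← ha', algebraMap_residue]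
    rfl)

/-- Functoriality of `W` for homomorphisms of `k_F`-algebras. -/
noncomputable def wittMap {E E' : Type*} [CommRing E] [Algebra (ResF p F) E] [CommRing E']
    [Algebra (ResF p F) E'] (f : E →ₐ[ResF p F] E') :
    WittVector p E →ₐ[WittVector p (ResF p F)] WittVector p E' where
  __ := WittVector.map (f : E →+* E')
  commutes' w := by
    ext n
    exact f.commutes _

/-- The isomorphism `W(Ẽ⁺) ⊗_{W(k_F)} 𝓞_F ≅ W(lim_{x ↦ x^q} 𝓞_{ℂ_F}/(π)) ⊗_{W(k_F)} 𝓞_F` induced by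
`tiltEquiv`. -/
noncomputable def wittTensorEquiv : WittTensor p F (EPlus p) ≃+* WittTensor p F (EPlusQ π) :=
  (Algebra.TensorProduct.congr
    (AlgEquiv.ofAlgHom (wittMap (tiltEquiv π).toAlgHom) (wittMap (tiltEquiv π).symm.toAlgHom)
      (AlgHom.ext fun _ => WittVector.ext fun _ => (tiltEquiv π).apply_symm_apply _)
      (AlgHom.ext fun _ => WittVector.ext fun _ => (tiltEquiv π).symm_apply_apply _))
    (AlgEquiv.refl : IntF p F ≃ₐ[WittVector p (ResF p F)] IntF p F)).toRingEquiv

/-- `γ : W_π(lim_{x ↦ x^q} 𝓞_{ℂ_F}/(π)) ≅ W(Ẽ⁺) ⊗_{W(k_F)} 𝓞_F` induces modulo `π` the identification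
`lim_{x ↦ x^q} 𝓞_{ℂ_F}/(π) ≅ Ẽ⁺` of the residue rings; here the residue ring of the source is
identified by the zeroth Witt component, and an element `e` of the residue ring `Ẽ⁺` of the target is
the class of `[e] ⊗ 1`. -/
def IsResidual
    (γ : Witt (IntF p F) π (cardRes p F) (EPlusQ π) ≃ₐ[IntF p F] WittTensor p F (EPlus p)) : Prop :=
  ∀ w, γ w - WittVector.teichmuller p ((tiltEquiv π).symm (w.coeff 0)) ⊗ₜ 1 ∈
    Ideal.span {algebraMap (IntF p F) (WittTensor p F (EPlus p)) π}

/-! ### The two `θ` maps -/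

/-- `z = ∑ π^i [a_i]` in `W(lim_{x ↦ x^q} 𝓞_{ℂ_F}/(π)) ⊗_{W(k_F)} 𝓞_F`, a `π`-adically convergent
sum. -/
def IsTeichmullerSum (a : ℕ → EPlusQ π) (z : WittTensor p F (EPlusQ π)) : Prop :=
  ∀ n, z - ∑ i ∈ Finset.range n, WittVector.teichmuller p (a i) ⊗ₜ (π ^ i) ∈
    Ideal.span {algebraMap (IntF p F) (WittTensor p F (EPlusQ π)) π} ^ n

/-- The sequence `(a_i)` such that `z = ∑ π^i [a_i]`. -/
noncomputable def digits (z : WittTensor p F (EPlusQ π)) : ℕ → EPlusQ π :=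
  Classical.epsilon fun a => IsTeichmullerSum π a z

variable {π} in
/-- `lim_j ã_j^{q^j}` for `a = (a_j) ∈ lim_{x ↦ x^q} 𝓞_{ℂ_F}/(π)`, where `ã_j` is a lift of `a_j`. -/
noncomputable def sharp (a : EPlusQ π) : 𝓞_ℂ_[p] :=
  limUnder Filter.atTop fun j => Quotient.out (a.1 j) ^ cardRes p F ^ j

/-- Fontaine's map `θ : ∑ π^i [a_i] ↦ ∑ π^i lim_j ã_{ij}^{q^j}`. -/
noncomputable def theta (z : WittTensor p F (EPlusQ π)) : 𝓞_ℂ_[p] :=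
  ∑' i, algebraMap (IntF p F) 𝓞_ℂ_[p] π ^ i * sharp (digits π z i)

/-- The ring homomorphism `lim_Fr W_π(𝓞_{ℂ_F}) → 𝓞_{ℂ_F}` sending a compatible system to the zeroth
Witt component of its first term. -/
noncomputable def wittTheta :
    Witt.frobLimit (IntF p F) π (cardRes p F) 𝓞_ℂ_[p] →ₐ[IntF p F] 𝓞_ℂ_[p] :=
  Witt.coeffZero.comp ((Pi.evalAlgHom (IntF p F) _ 0).comp (Subalgebra.val _))

end localField

end RamifiedWitt

open RamifiedWitt Filter
open scoped TensorProduct Topology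

namespace RamifiedWitt

open Finset

/-! ### Completeness with respect to an element -/

/-! Everything rests on one notion, a strict lift of a perfect `k_F`-algebra `E`: a `π`-torsion
free, `π`-adically complete `𝓞_F`-algebra `T` with `T/π = E` and a multiplicative section `τ`.
Peeling off residues and dividing by `π` shows that each element of `T` is a unique sum `∑ π^i
τ(a_i)`.

Let `r` be the inverse of `x ↦ x^q` on `E`. The candidate for `γ` is `x ↦ ∑ π^i τ(r^i x_i)`. It is
visibly bijective; the point is that it is a ring homomorphism. Since `τ(r^n x_i)^(q^(n-i)) = τ(r^i
x_i)`, the sum truncated after `i = n` is the `n`-th ghost component of the sequence `τ(r^n x_i)`,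
and modulo `π^(n+1)` that ghost component depends only on the entries modulo `π`
(`isExpansion_iff`). Hence any lift of `W_π(r^n)(x)` to `W_π(T)` may be used, and sums and products
of lifts are lifts of sums and products (`exists_witt_equiv`). Uniqueness of `γ` holds because `τ(a)
= τ(r^n a)^(q^n)`: an endomorphism that is the identity modulo `π` fixes each `τ(a)` modulo every
power of `π` (`endomorphism_eq_id`).

The ring `W(E) ⊗ 𝓞_F` is such a strict lift (`isStrictLift_wittTensor`): `𝓞_F` is finite free over
`W(k_F)`, so the tensor product has a finite basis over `W(E)` and inherits torsion-freeness and
completeness for `p`, hence for `π`, as `π ∣ p ∣ π^M`.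

Reduction modulo `π` is bijective on Frobenius limits because the Frobenius of `W_π(𝓞_ℂ)` is
contracting: it turns congruences modulo `π^(k+1)` of all components into congruences modulo
`π^(k+2)` (`frob_congr`). Over `𝓞_ℂ/π` the Frobenius is the componentwise `q`-power, so exchanging
indices is a bijection.

Finally, Frobenius shifts ghost components, so the zeroth component of the first term of `x` is the
`n`-th ghost component of the `n`-th term, for every `n`. Letting `n` grow, its summands tend to
`π^i` times the limits in the definition of `θ`, with exactly the digits `r^i x_i` of the image
under `γ` (`hasSum_wittTheta`). -/

/-- The ring `R` is `t`-adically separated and complete. -/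
structure AdicallyComplete {R : Type*} [CommRing R] (t : R) : Prop where
  eq_zero_of_forall_dvd : ∀ x : R, (∀ n, t ^ n ∣ x) → x = 0
  exists_limit : ∀ f : ℕ → R, (∀ n, t ^ n ∣ f (n + 1) - f n) → ∃ L, ∀ n, t ^ n ∣ L - f n

theorem pow_dvd_sub_of_le {R : Type*} [CommRing R] {t : R} {f : ℕ → R}
    (hf : ∀ n, t ^ n ∣ f (n + 1) - f n) {m n : ℕ} (h : m ≤ n) : t ^ m ∣ f n - f m := by
  induction n, h using Nat.le_induction with
  | base => simp
  | succ n hmn ih =>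
    rw [← sub_add_sub_cancel]
    exact dvd_add ((pow_dvd_pow t hmn).trans (hf n)) ih

namespace AdicallyComplete

variable {R : Type*} [CommRing R] {s t : R}

theorem eq_of_forall_dvd (h : AdicallyComplete t) {x y : R} (hxy : ∀ n, t ^ n ∣ x - y) : x = y :=
  sub_eq_zero.1 (h.eq_zero_of_forall_dvd _ hxy)

/-- The powers of `s` and of `t` are cofinal for divisibility, so they define the same topology.
Used to pass from `p` to `π`. -/
theorem of_dvd (h : AdicallyComplete s) (hts : t ∣ s) {M : ℕ} (hM : s ∣ t ^ M) :
    AdicallyComplete t where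
  eq_zero_of_forall_dvd x hx := h.eq_zero_of_forall_dvd x fun n =>
    (pow_dvd_pow_of_dvd hM n).trans (by rw [← pow_mul]; exact hx _)
  exists_limit f hf := by
    -- The factor `M + 1` is positive even if `M = 0`, so the subsequence index `(M + 1) * n` is at
    -- least `n`.
    have hM' : s ∣ t ^ (M + 1) := hM.trans (pow_dvd_pow t M.le_succ)
    obtain ⟨L, hL⟩ := h.exists_limit (fun n => f ((M + 1) * n)) fun n =>
      (pow_dvd_pow_of_dvd hM' n).trans (by
        rw [← pow_mul]
        exact pow_dvd_sub_of_le hf (Nat.mul_le_mul_left _ n.le_succ))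
    refine ⟨L, fun n => ?_⟩
    rw [← sub_add_sub_cancel L (f ((M + 1) * n))]
    exact dvd_add ((pow_dvd_pow_of_dvd hts n).trans (hL n))
      (pow_dvd_sub_of_le hf (Nat.le_mul_of_pos_left _ M.succ_pos))

end AdicallyComplete

/-! ### Strict lifts of perfect algebras -/

section strict

variable {A : Type*} [CommRing A] {π : A} {q : ℕ} {T E : Type*} [CommRing T] [Algebra A T]
  [CommRing E] [Algebra A E]

/-- `T` is a `π`-adically complete `π`-torsion free lift of the `A/π`-algebra `E`, with
multiplicative section `τ`. -/
structure IsStrictLift (π : A) (ρ : T →ₐ[A] E) (τ : E →* T) : Prop where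
  regular : ∀ x : T, algebraMap A T π * x = 0 → x = 0
  complete : AdicallyComplete (algebraMap A T π)
  dvd_of_map_eq_zero : ∀ x : T, ρ x = 0 → algebraMap A T π ∣ x
  algebraMap_eq_zero : algebraMap A E π = 0
  map_section : ∀ a, ρ (τ a) = a

/-- `z` is the `π`-adically convergent sum `∑ π^i τ(a_i)`. -/
def IsExpansion (π : A) (τ : E → T) (a : ℕ → E) (z : T) : Prop :=
  ∀ n, algebraMap A T π ^ n ∣ z - ∑ i ∈ range n, algebraMap A T π ^ i * τ (a i)

namespace IsStrictLift

variable {ρ : T →ₐ[A] E} {τ : E →* T}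

theorem dvd_iff (h : IsStrictLift π ρ τ) (x : T) : algebraMap A T π ∣ x ↔ ρ x = 0 := by
  refine ⟨?_, h.dvd_of_map_eq_zero x⟩
  rintro ⟨y, rfl⟩
  rw [map_mul, AlgHom.commutes, h.algebraMap_eq_zero, zero_mul]

theorem dvd_sub_iff (h : IsStrictLift π ρ τ) (x y : T) : algebraMap A T π ∣ x - y ↔ ρ x = ρ y := by
  rw [h.dvd_iff, map_sub, sub_eq_zero]

theorem pow_regular (h : IsStrictLift π ρ τ) (n : ℕ) (x : T)
    (hx : algebraMap A T π ^ n * x = 0) : x = 0 := by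
  induction n with
  | zero => simpa using hx
  | succ n ih => exact ih (h.regular _ (by rw [← mul_assoc, ← pow_succ', hx]))

/-- Write `y = τ(ρ y) + π g(y)` and iterate `g`: the digits are the residues of the iterates, and
`g^[n] z` is the remainder after `n` steps. -/
theorem exists_expansion (h : IsStrictLift π ρ τ) (z : T) : ∃ a, IsExpansion π τ a z := by
  have step : ∀ y : T, ∃ y', y = τ (ρ y) + algebraMap A T π * y' := by
    intro y
    obtain ⟨y', hy'⟩ := (h.dvd_sub_iff y (τ (ρ y))).2 (h.map_section _).symm
    exact ⟨y', by rw [← hy']; ring⟩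
  choose g hg using step
  refine ⟨fun i => ρ (g^[i] z), fun n => ⟨g^[n] z, ?_⟩⟩
  induction n with
  | zero => simp
  | succ n ih =>
    rw [sum_range_succ, ← sub_sub, ih, Function.iterate_succ_apply']
    conv_lhs => arg 1; rw [hg (g^[n] z)]
    ring

/-- If the digits agree below `n`, subtracting the truncations leaves `π^n (τ(a_n) - τ(b_n))`
divisible by `π^(n+1)`; cancel `π^n` and reduce. -/
theorem expansion_unique (h : IsStrictLift π ρ τ) {a b : ℕ → E} {z : T} (ha : IsExpansion π τ a z)
    (hb : IsExpansion π τ b z) : a = b := by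
  funext n
  induction n using Nat.strong_induction_on with
  | _ n ih =>
    have h1 := dvd_sub (hb (n + 1)) (ha (n + 1))
    rw [sum_range_succ, sum_range_succ,
      sum_congr rfl fun i hi => by rw [← ih i (by simpa using hi)]] at h1
    obtain ⟨c, hc⟩ := h1
    have h2 : τ (a n) - τ (b n) - algebraMap A T π * c = 0 := by
      refine h.pow_regular n _ ?_
      rw [pow_succ] at hc
      linear_combination hc
    have h3 := (h.dvd_sub_iff (τ (a n)) (τ (b n))).1 ⟨c, sub_eq_zero.1 h2⟩
    rwa [h.map_section, h.map_section] at h3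

theorem exists_sum (h : IsStrictLift π ρ τ) (a : ℕ → E) : ∃ z, IsExpansion π τ a z :=
  h.complete.exists_limit (fun n => ∑ i ∈ range n, algebraMap A T π ^ i * τ (a i)) fun n => by
    rw [sum_range_succ, add_sub_cancel_left]
    exact dvd_mul_right _ _

theorem sum_unique (h : IsStrictLift π ρ τ) {a : ℕ → E} {z z' : T} (hz : IsExpansion π τ a z)
    (hz' : IsExpansion π τ a z') : z = z' :=
  h.complete.eq_of_forall_dvd fun n => by simpa using dvd_sub (hz n) (hz' n)

variable {r : E →ₐ[A] E}

theorem root_pow (hr : ∀ x, r x ^ q = x) (n : ℕ) (x : E) : (r ^ n) x ^ q ^ n = x := by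
  induction n with
  | zero => simp
  | succ n ih => rw [pow_succ', AlgHom.mul_apply, pow_succ', pow_mul, hr, ih]

theorem pow_root (hr : ∀ x, r x ^ q = x) (n : ℕ) (x : E) : (r ^ n) (x ^ q ^ n) = x := by
  rw [map_pow, root_pow hr]

/-- The exponent `q^(n-i)` in the ghost component undoes `n - i` of the `n` root extractions. This
is how truncated expansions become ghost components. -/
theorem ghost_section_root (hr : ∀ x, r x ^ q = x) (x : ℕ → E) (n : ℕ) :
    ghost π q (fun i => τ ((r ^ n) (x i))) n =
      ∑ i ∈ range (n + 1), algebraMap A T π ^ i * τ ((r ^ i) (x i)) := by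
  refine sum_congr rfl fun i hi => ?_
  have hi : i ≤ n := by simpa [Nat.lt_succ_iff] using hi
  beta_reduce
  rw [← map_pow τ]
  conv_lhs => rw [← Nat.sub_add_cancel hi, pow_add r, AlgHom.mul_apply, Nat.add_sub_cancel]
  rw [root_pow hr]

variable [Base A π q]

/-- An expansion is determined by its values modulo powers of `π`, which can be computed from any
lift of the `q^n`-th roots of the digits. -/
theorem isExpansion_iff (h : IsStrictLift π ρ τ) (hr : ∀ x, r x ^ q = x)
    (x : ℕ → E) (z : T) :
    IsExpansion π τ (fun i => (r ^ i) (x i)) z ↔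
      ∀ n, ∀ y : ℕ → T, (∀ i, ρ (y i) = (r ^ n) (x i)) →
        algebraMap A T π ^ (n + 1) ∣ z - ghost π q y n := by
  -- Both sequences lift the same elements of `E`, so their `n`-th ghost components agree modulo
  -- `π^(n+1)`.
  have key : ∀ n, ∀ y : ℕ → T, (∀ i, ρ (y i) = (r ^ n) (x i)) → algebraMap A T π ^ (n + 1) ∣
      (∑ i ∈ range (n + 1), algebraMap A T π ^ i * τ ((r ^ i) (x i))) - ghost π q y n := by
    intro n y hy
    rw [← ghost_section_root hr x n]
    exact dvd_ghost_sub fun i _ => by rw [h.dvd_sub_iff, h.map_section, hy]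
  constructor
  · intro hz n y hy
    rw [← sub_add_sub_cancel]
    exact dvd_add (hz (n + 1)) (key n y hy)
  · rintro hz (_ | n)
    · simp
    -- Test the hypothesis on the multiplicative lifts only; the case of exponent `0` was vacuous.
    · have hy : ∀ i, ρ (τ ((r ^ n) (x i))) = (r ^ n) (x i) := fun i => h.map_section _
      have h2 := dvd_sub (hz n _ hy) (key n _ hy)
      rwa [sub_sub_sub_cancel_right] at h2

/-- The ring of ramified Witt vectors of `E` is the strict lift of `E`. -/
theorem exists_witt_equiv (h : IsStrictLift π ρ τ) (hr : ∀ x, r x ^ q = x) :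
     ∃ γ : Witt A π q E ≃ₐ[A] T,
    ∀ x, IsExpansion π τ (fun i => (r ^ i) (x.coeff i)) (γ x) := by
  choose g hg using fun x : Witt A π q E => h.exists_sum fun i => (r ^ i) (x.coeff i)
  have hg' := fun x => (h.isExpansion_iff hr _ _).1 (hg x)
  let lift : ℕ → Witt A π q E → Witt A π q T := fun n x => ⟨fun i => τ ((r ^ n) (x.coeff i))⟩
  have hlift : ∀ n x, Witt.map ρ (lift n x) = Witt.map (r ^ n) x := fun n x =>
    Witt.ext (funext fun i => h.map_section _)
  have hlift' : ∀ n x i, ρ ((lift n x).coeff i) = (r ^ n) (x.coeff i) := fun n x i =>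
    h.map_section _
  have hcoeff : ∀ {n : ℕ} {y : Witt A π q T} {x : Witt A π q E},
      Witt.map ρ y = Witt.map (r ^ n) x → ∀ i, ρ (y.coeff i) = (r ^ n) (x.coeff i) :=
    fun e i => congrFun (congrArg Witt.coeff e) i
  -- To compute `g x` it suffices to have, for each `n`, a single Witt vector over `T` lifting the
  -- `q^n`-th roots of `x` whose `n`-th ghost component approximates `z`. Each homomorphism law
  -- below is then checked on one obvious lift.
  have hmap : ∀ (x : Witt A π q E) (z : T), (∀ n, ∃ y : Witt A π q T,
      Witt.map ρ y = Witt.map (r ^ n) x ∧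
        algebraMap A T π ^ (n + 1) ∣ z - ghost π q y.coeff n) → g x = z := by
    intro x z hz
    refine h.complete.eq_of_forall_dvd fun n => ?_
    obtain ⟨y, hy, hyz⟩ := hz n
    have := dvd_sub (hg' x n _ (hcoeff hy)) hyz
    rw [sub_sub_sub_cancel_right] at this
    exact (pow_dvd_pow _ n.le_succ).trans this
  let φ : Witt A π q E →ₐ[A] T :=
    { toFun := g
      map_one' := hmap _ _ fun n => ⟨1, by rw [map_one, map_one], by simp [Witt.ghost_one]⟩
      map_zero' := hmap _ _ fun n => ⟨0, by rw [map_zero, map_zero], by simp [Witt.ghost_zero']⟩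
      map_add' := fun x y => hmap _ _ fun n => ⟨lift n x + lift n y, by
          rw [map_add, map_add, hlift, hlift], by
          rw [Witt.ghost_add, add_sub_add_comm]
          exact dvd_add (hg' x n _ (hlift' n x)) (hg' y n _ (hlift' n y))⟩
      map_mul' := fun x y => hmap _ _ fun n => ⟨lift n x * lift n y, by
          rw [map_mul, map_mul, hlift, hlift], by
          rw [Witt.ghost_mul]
          -- With ghost components `u`, `v` of the lifts, `g x * g y - u * v = (g x - u) * g y + u *
          -- (g y - v)`.
          have h1 := (hg' x n _ (hlift' n x)).mul_right (g y)
          have h2 := (hg' y n _ (hlift' n y)).mul_left (ghost π q (lift n x).coeff n)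
          convert dvd_add h1 h2 using 1
          ring⟩
      commutes' := fun a => hmap _ _ fun n => ⟨algebraMap A _ a, by
          rw [AlgHom.commutes, AlgHom.commutes], by
          rw [Witt.algebraMap_eq, Witt.ghost_const, sub_self]
          exact dvd_zero _⟩ }
  refine ⟨AlgEquiv.ofBijective φ ⟨fun x y hxy => ?_, fun z => ?_⟩, hg⟩
  · have hxy : g x = g y := hxy
    have hx := hg x
    rw [hxy] at hx
    have h1 := h.expansion_unique hx (hg y)
    refine Witt.ext (funext fun i => ?_)
    rw [← root_pow hr i (x.coeff i), congrFun h1 i, root_pow hr]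
  · obtain ⟨a, ha⟩ := h.exists_expansion z
    -- The power `q^i` compensates the `r ^ i` in the digits of `g`.
    refine ⟨⟨fun i => a i ^ q ^ i⟩, h.sum_unique (hg _) ?_⟩
    simpa only [pow_root hr] using ha

/-- An endomorphism of a strict lift that induces the identity of `E` is the identity. -/
theorem endomorphism_eq_id (h : IsStrictLift π ρ τ) (hr : ∀ x, r x ^ q = x)
    (φ : T →ₐ[A] T) (hφ : ∀ z, ρ (φ z) = ρ z) (z : T) : φ z = z := by
  have h1 : ∀ a, φ (τ a) = τ a := by
    intro a
    refine h.complete.eq_of_forall_dvd fun n => ?_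
    -- `φ` fixes `τ(r^n a)` modulo `π`; raising to the power `q^n` improves this to `τ(a)` modulo
    -- `π^(n+1)`.
    have h2 := pow_q_pow_congr (q := q) ((h.dvd_sub_iff _ _).2 (hφ (τ ((r ^ n) a)))) n
    rw [← map_pow φ, ← map_pow τ, root_pow hr] at h2
    exact (pow_dvd_pow _ n.le_succ).trans h2
  obtain ⟨a, ha⟩ := h.exists_expansion z
  refine h.sum_unique (fun n => ?_) ha
  have h2 := map_dvd φ (ha n)
  simpa [map_sub, map_sum, h1] using h2

end IsStrictLift

end strict

end RamifiedWitt

namespace RamifiedWitt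

open Finset

/-! ### The inverse limit along the Frobenius -/

section frobLimit

variable {A : Type*} [CommRing A] {π : A} {q : ℕ} {O : Type*} [CommRing O] [Algebra A O]
  [Base A π q]

/-- Both sides are the same double sequences: since `π = 0` in `O/(π)`, Frobenius compatibility of
the terms means compatibility of each component under `x ↦ x^q`. -/
theorem permute_bijective : Function.Bijective (permute π q O) := by
  constructor
  · intro x y hxy
    refine Subtype.ext (funext fun j => ?_)
    have h := congrArg (Witt.map (powLimitProj π q O j)) hxy
    exact h
  · intro w
    refine ⟨⟨fun j => Witt.map (powLimitProj π q O j) w, fun j => Witt.ext (funext fun i => ?_)⟩,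
      rfl⟩
    rw [Witt.coeff_frob (algebraMap_modPi π O)]
    exact (w.coeff i).2 j

theorem pow_q_pow_congr_of_pow {a b : O} {k : ℕ} (h : algebraMap A O π ^ (k + 1) ∣ a - b)
    (j : ℕ) : algebraMap A O π ^ (k + j + 1) ∣ a ^ q ^ j - b ^ q ^ j := by
  induction j with
  | zero => simpa using h
  | succ j ih => rw [pow_succ q j, pow_mul, pow_mul]; exact pow_q_congr ih

/-- The factor `π^i` contributes `i` to the exponent and the `n - i` successive `q`-th powers
contribute one each, so every summand gains exactly `n`. -/
theorem ghost_summand_congr {a b : O} {k : ℕ} (h : algebraMap A O π ^ (k + 1) ∣ a - b)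
    {i n : ℕ} (hi : i ≤ n) : algebraMap A O π ^ (n + k + 1) ∣
      algebraMap A O π ^ i * a ^ q ^ (n - i) - algebraMap A O π ^ i * b ^ q ^ (n - i) := by
  rw [← mul_sub]
  have e : n + k + 1 = i + (k + (n - i) + 1) := by omega
  rw [e, pow_add]
  exact mul_dvd_mul_left _ (pow_q_pow_congr_of_pow h _)

theorem ghost_congr {x y : ℕ → O} {k : ℕ} (h : ∀ i, algebraMap A O π ^ (k + 1) ∣ x i - y i)
    (n : ℕ) : algebraMap A O π ^ (n + k + 1) ∣ ghost π q x n - ghost π q y n := by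
  unfold ghost
  rw [← sum_sub_distrib]
  exact dvd_sum fun i hi => ghost_summand_congr (h i) (by simpa [Nat.lt_succ_iff] using hi)

theorem pow_dvd_of_pow_mul_dvd (hreg : ∀ b : O, algebraMap A O π * b = 0 → b = 0) {n k : ℕ}
    {b : O} (h : algebraMap A O π ^ (n + k) ∣ algebraMap A O π ^ n * b) :
    algebraMap A O π ^ k ∣ b := by
  induction n with
  | zero => simpa using h
  | succ n ih =>
    refine ih ?_
    obtain ⟨c, hc⟩ := h
    refine ⟨c, sub_eq_zero.1 (hreg _ ?_)⟩
    rw [Nat.succ_add, pow_succ, pow_succ] at hc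
    linear_combination hc

/-- Converse of `ghost_congr` in the torsion free case: once the earlier components are congruent,
only `π^n (x_n - y_n)` is left, and `π^n` can be cancelled. -/
theorem congr_of_ghost_congr (hreg : ∀ b : O, algebraMap A O π * b = 0 → b = 0) {x y : ℕ → O}
    {k : ℕ} (h : ∀ n, algebraMap A O π ^ (n + k + 1) ∣ ghost π q x n - ghost π q y n) (n : ℕ) :
    algebraMap A O π ^ (k + 1) ∣ x n - y n := by
  induction n using Nat.strong_induction_on with
  | _ n ih =>
    have h1 := h n
    unfold ghost at h1
    rw [sum_range_succ, sum_range_succ, add_sub_add_comm, ← sum_sub_distrib] at h1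
    have h2 := (dvd_add_right (dvd_sum fun i hi =>
      ghost_summand_congr (q := q) (ih i (by simpa using hi)) (mem_range.1 hi).le)).1 h1
    simp only [Nat.sub_self, pow_zero, pow_one] at h2
    rw [← mul_sub] at h2
    exact pow_dvd_of_pow_mul_dvd hreg h2

/-- The Frobenius is contracting: its `n`-th ghost component is the `(n+1)`-st of the argument,
whose congruence has one more factor `π`. -/
theorem frob_congr (hreg : ∀ b : O, algebraMap A O π * b = 0 → b = 0) {x y : Witt A π q O}
    {k : ℕ} (h : ∀ i, algebraMap A O π ^ (k + 1) ∣ x.coeff i - y.coeff i) (i : ℕ) :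
    algebraMap A O π ^ (k + 2) ∣ (Witt.frob x).coeff i - (Witt.frob y).coeff i := by
  refine congr_of_ghost_congr (q := q) hreg (fun n => ?_) i
  rw [Witt.ghost_frob, Witt.ghost_frob]
  have := ghost_congr (q := q) h (n + 1)
  rwa [show n + 1 + k + 1 = n + (k + 1) + 1 by omega] at this

theorem iterate_frob_congr (hreg : ∀ b : O, algebraMap A O π * b = 0 → b = 0)
    {x y : Witt A π q O} (h : ∀ i, algebraMap A O π ∣ x.coeff i - y.coeff i) (k i : ℕ) :
    algebraMap A O π ^ (k + 1) ∣ (Witt.frob^[k] x).coeff i - (Witt.frob^[k] y).coeff i := by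
  induction k generalizing i with
  | zero => simpa using h i
  | succ k ih =>
    rw [Function.iterate_succ_apply', Function.iterate_succ_apply']
    exact frob_congr hreg ih i

theorem map_mk_eq_iff (x y : Witt A π q O) :
    Witt.map (Ideal.Quotient.mkₐ A (Ideal.span {algebraMap A O π})) x =
      Witt.map (Ideal.Quotient.mkₐ A _) y ↔ ∀ i, algebraMap A O π ∣ x.coeff i - y.coeff i := by
  simp only [← Ideal.mem_span_singleton, ← Ideal.Quotient.eq]
  exact ⟨fun h i => congrFun (congrArg Witt.coeff h) i, fun h => Witt.ext (funext h)⟩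

/-- Each term is the Frobenius of the next one, so a congruence holding for all terms improves
itself by one power of `π`, indefinitely. -/
theorem reduce_injective (hreg : ∀ b : O, algebraMap A O π * b = 0 → b = 0)
    (hO : AdicallyComplete (algebraMap A O π)) : Function.Injective (reduce π q O) := by
  intro x y hxy
  have h : ∀ k j i, algebraMap A O π ^ (k + 1) ∣ (x.1 j).coeff i - (y.1 j).coeff i := by
    intro k
    induction k with
    | zero =>
      intro j
      simpa using (map_mk_eq_iff _ _).1 (congrFun (congrArg Subtype.val hxy) j)
    | succ k ih =>
      intro j
      rw [← x.2 j, ← y.2 j]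
      exact frob_congr hreg (ih (j + 1))
  exact Subtype.ext (funext fun j => Witt.ext (funext fun i => hO.eq_of_forall_dvd fun n =>
    (pow_dvd_pow _ n.le_succ).trans (h n j i)))

/-- Lift every term arbitrarily to `v j`. The `j`-th term of the preimage is the limit of `Fr^n (v
(j + n))`, which converges by contraction because `Fr (v (j + n + 1))` and `v (j + n)` have the same
reduction. -/
theorem reduce_surjective (hreg : ∀ b : O, algebraMap A O π * b = 0 → b = 0)
    (hO : AdicallyComplete (algebraMap A O π)) : Function.Surjective (reduce π q O) := by
  intro y
  have hsurj : ∀ w : Witt A π q (ModPi π O), ∃ v : Witt A π q O,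
      Witt.map (Ideal.Quotient.mkₐ A (Ideal.span {algebraMap A O π})) v = w := by
    intro w
    choose l hl using fun i => Ideal.Quotient.mk_surjective (w.coeff i)
    exact ⟨⟨l⟩, Witt.ext (funext hl)⟩
  choose v hv using fun j => hsurj (y.1 j)
  have hfrob : ∀ j, Witt.map (Ideal.Quotient.mkₐ A (Ideal.span {algebraMap A O π}))
      (Witt.frob (v (j + 1))) = y.1 j := fun j => by rw [Witt.frob_map, hv, y.2 j]
  let f : ℕ → ℕ → Witt A π q O := fun j n => Witt.frob^[n] (v (j + n))
  have hf : ∀ j n i, algebraMap A O π ^ (n + 1) ∣ (f j (n + 1)).coeff i - (f j n).coeff i :=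
    fun j n i => iterate_frob_congr hreg
      ((map_mk_eq_iff _ _).1 ((hfrob (j + n)).trans (hv (j + n)).symm)) n i
  have hfs : ∀ j n, Witt.frob (f (j + 1) n) = f j (n + 1) := fun j n => by
    change Witt.frob (Witt.frob^[n] _) = Witt.frob^[n + 1] _
    rw [Function.iterate_succ_apply', add_right_comm, add_assoc]
  choose L hL using fun j i => hO.exists_limit (fun n => (f j n).coeff i) fun n =>
    (pow_dvd_pow _ n.le_succ).trans (hf j n i)
  refine ⟨⟨fun j => ⟨L j⟩, fun j => Witt.ext (funext fun i =>
    hO.eq_of_forall_dvd fun n => ?_)⟩, Subtype.ext (funext fun j => ?_)⟩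
  -- Compatibility of the limits: `Fr` of the `(n+1)`-st approximation of term `j + 1` is the
  -- `(n+2)`-nd approximation of term `j`.
  · have h1 := frob_congr (q := q) hreg (x := ⟨L (j + 1)⟩) (fun i => hL (j + 1) i (n + 1)) i
    rw [hfs] at h1
    have h2 := dvd_sub h1 (hL j i (n + 2))
    rw [sub_sub_sub_cancel_right] at h2
    exact (pow_dvd_pow _ (by omega)).trans h2
  · refine Eq.trans ((map_mk_eq_iff _ _).2 fun i => ?_) (hfrob j)
    -- The approximation of index `1`, namely `Fr (v (j + 1))`, is used because index `0` only gives
    -- a congruence modulo `π^0`.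
    have h := hL j i 1
    rwa [pow_one] at h

end frobLimit

end RamifiedWitt

namespace RamifiedWitt

open Finset Filter
open scoped Topology

/-! ### The ring of integers of `ℂ_p` -/

section complexInt

variable {p : ℕ} [Fact p.Prime]

theorem complexInt_dvd_iff (x y : 𝓞_ℂ_[p]) : y ∣ x ↔ ‖(x : ℂ_[p])‖ ≤ ‖(y : ℂ_[p])‖ := by
  constructor
  · rintro ⟨c, rfl⟩
    rw [show ((y * c : 𝓞_ℂ_[p]) : ℂ_[p]) = y * c from rfl, norm_mul]
    exact mul_le_of_le_one_right (norm_nonneg _) ((mem_padicComplexInt p _).1 c.2)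
  · intro h
    by_cases hy : (y : ℂ_[p]) = 0
    · rw [hy, norm_zero, norm_le_zero_iff] at h
      rw [show x = 0 from Subtype.ext h]
      exact dvd_zero _
    · refine ⟨⟨x / y, (mem_padicComplexInt p _).2 ?_⟩, Subtype.ext ?_⟩
      · rw [norm_div]
        exact div_le_one_of_le₀ h (norm_nonneg _)
      · change (x : ℂ_[p]) = y * (x / y)
        field_simp

theorem complexInt_pow_dvd_iff (t x : 𝓞_ℂ_[p]) (n : ℕ) :
    t ^ n ∣ x ↔ ‖(x : ℂ_[p])‖ ≤ ‖(t : ℂ_[p])‖ ^ n := by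
  rw [complexInt_dvd_iff, ← norm_pow]; rfl

theorem tendsto_of_pow_dvd {t : 𝓞_ℂ_[p]} (ht : ‖(t : ℂ_[p])‖ < 1) {f : ℕ → 𝓞_ℂ_[p]}
    {L : 𝓞_ℂ_[p]} (h : ∀ n, t ^ n ∣ L - f n) : Tendsto f atTop (𝓝 L) := by
  rw [tendsto_subtype_rng, tendsto_iff_norm_sub_tendsto_zero]
  refine squeeze_zero (fun _ => norm_nonneg _) (fun n => ?_)
    (tendsto_pow_atTop_nhds_zero_of_lt_one (norm_nonneg _) ht)
  rw [norm_sub_rev]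
  exact (complexInt_pow_dvd_iff _ _ _).1 (h n)

theorem complexInt_adicallyComplete {t : 𝓞_ℂ_[p]} (ht : ‖(t : ℂ_[p])‖ < 1) :
    AdicallyComplete t where
  eq_zero_of_forall_dvd x hx := by
    have := ge_of_tendsto' (tendsto_pow_atTop_nhds_zero_of_lt_one (norm_nonneg _) ht)
      fun n => (complexInt_pow_dvd_iff _ _ _).1 (hx n)
    exact Subtype.ext (norm_le_zero_iff.1 this)
  exists_limit f hf := by
    have hf' : ∀ m n, m ≤ n → ‖(f n : ℂ_[p]) - f m‖ ≤ ‖(t : ℂ_[p])‖ ^ m := fun m n hmn =>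
      (complexInt_pow_dvd_iff _ _ _).1 (pow_dvd_sub_of_le hf hmn)
    have hc : CauchySeq fun n => (f n : ℂ_[p]) :=
      cauchySeq_of_le_tendsto_0' (fun n => ‖(t : ℂ_[p])‖ ^ n)
        (fun m n hmn => by rw [dist_comm, dist_eq_norm]; exact hf' m n hmn)
        (tendsto_pow_atTop_nhds_zero_of_lt_one (norm_nonneg _) ht)
    obtain ⟨L, hL⟩ := cauchySeq_tendsto_of_complete hc
    have hL1 : ‖L‖ ≤ 1 := le_of_tendsto' hL.norm fun n => (mem_padicComplexInt p _).1 (f n).2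
    refine ⟨⟨L, (mem_padicComplexInt p _).2 hL1⟩, fun n => (complexInt_pow_dvd_iff _ _ _).2 ?_⟩
    refine le_of_tendsto (hL.sub_const (f n : ℂ_[p])).norm ?_
    filter_upwards [eventually_ge_atTop n] with m hm using hf' n m hm

theorem hasSum_of_pow_dvd {t : 𝓞_ℂ_[p]} (ht : ‖(t : ℂ_[p])‖ < 1) {s : ℕ → 𝓞_ℂ_[p]}
    {L : 𝓞_ℂ_[p]} (h : ∀ n, t ^ n ∣ L - ∑ i ∈ range n, t ^ i * s i) :
    HasSum (fun i => t ^ i * s i) L := by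
  -- Unconditional summability is proved in the complete normed field `ℂ_p` by comparison with a
  -- geometric series.
  rw [← (Topology.IsInducing.subtypeVal).hasSum_iff (g := (PadicComplexInt p).subtype)]
  have hsum : Summable ((PadicComplexInt p).subtype ∘ fun i => t ^ i * s i) := by
    refine Summable.of_norm_bounded (summable_geometric_of_lt_one (norm_nonneg _) ht) fun i => ?_
    exact (complexInt_pow_dvd_iff _ _ _).1 (dvd_mul_right _ _)
  refine (hsum.hasSum_iff_tendsto_nat).2 ?_
  have := (continuous_subtype_val.tendsto _).comp (tendsto_of_pow_dvd ht h)
  refine this.congr fun n => ?_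
  exact map_sum (PadicComplexInt p).subtype _ _

variable {F : Type*} [Field F] [Algebra F ℂ_[p]]

theorem norm_uniformizer_lt_one (π : IntF p F)
    [hπ : Fact (Ideal.span {π} = IsLocalRing.maximalIdeal (IntF p F))] :
    ‖(algebraMap (IntF p F) 𝓞_ℂ_[p] π : ℂ_[p])‖ < 1 := by
  rw [coe_algebraMap, ← mem_maximalIdeal_iff, ← hπ.out]
  exact Ideal.mem_span_singleton_self _

theorem algebraMap_complexInt_injective :
    Function.Injective (algebraMap (IntF p F) 𝓞_ℂ_[p]) := fun _ _ h =>
  Subtype.ext ((algebraMap F ℂ_[p]).injective (congrArg Subtype.val h))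

end complexInt

/-! ### Limits of `q`-th powers and Fontaine's map -/

section localField

variable {p : ℕ} [Fact p.Prime] {F : Type*} [Field F] [Algebra ℚ_[p] F] [FiniteDimensional ℚ_[p] F]
  [Algebra F ℂ_[p]] [IsScalarTower ℚ_[p] F ℂ_[p]]
variable (π : IntF p F) [hπ : Fact (Ideal.span {π} = IsLocalRing.maximalIdeal (IntF p F))]

theorem uniformizer_ne_zero : π ≠ 0 := by
  intro h
  refine one_ne_zero (Base.regular (π := π) (q := cardRes p F) 1 ?_)
  rw [h, zero_mul]

theorem complexInt_uniformizer_regular (b : 𝓞_ℂ_[p])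
    (h : algebraMap (IntF p F) 𝓞_ℂ_[p] π * b = 0) : b = 0 :=
  (mul_eq_zero.1 h).resolve_left fun h0 =>
    uniformizer_ne_zero π (algebraMap_complexInt_injective (h0.trans (map_zero _).symm))

variable {π}

theorem dvd_lift_pow_sub {a : EPlusQ π} {l : ℕ → 𝓞_ℂ_[p]}
    (hl : ∀ j, Ideal.Quotient.mk _ (l j) = a.1 j) (j : ℕ) :
    algebraMap (IntF p F) 𝓞_ℂ_[p] π ^ (j + 1) ∣
      l (j + 1) ^ cardRes p F ^ (j + 1) - l j ^ cardRes p F ^ j := by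
  rw [pow_succ' (cardRes p F), pow_mul]
  refine pow_q_pow_congr ?_ j
  rw [← Ideal.mem_span_singleton, ← Ideal.Quotient.eq, map_pow, hl, hl, a.2 j]

/-- Two lifts of `a_j` agree modulo `π`, so their `q^j`-th powers agree modulo `π^(j+1)`. This
replaces the chosen lifts in `sharp` by arbitrary ones, with an explicit rate. -/
theorem dvd_sharp_sub {a : EPlusQ π} {l : ℕ → 𝓞_ℂ_[p]}
    (hl : ∀ j, Ideal.Quotient.mk _ (l j) = a.1 j) (j : ℕ) :
    algebraMap (IntF p F) 𝓞_ℂ_[p] π ^ (j + 1) ∣ sharp a - l j ^ cardRes p F ^ j := by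
  have hO := complexInt_adicallyComplete (norm_uniformizer_lt_one π)
  have hl' : ∀ j, Ideal.Quotient.mk _ (Quotient.out (a.1 j)) = a.1 j :=
    fun j => Quotient.out_eq (a.1 j)
  obtain ⟨L, hL⟩ := hO.exists_limit (fun j => Quotient.out (a.1 j) ^ cardRes p F ^ j) fun j =>
    (pow_dvd_pow _ j.le_succ).trans (dvd_lift_pow_sub hl' j)
  have hs : sharp a = L := (tendsto_of_pow_dvd (norm_uniformizer_lt_one π) hL).limUnder_eq
  rw [hs, ← sub_add_sub_cancel _ (Quotient.out (a.1 j) ^ cardRes p F ^ j)]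
  refine dvd_add ?_ (pow_q_pow_congr ?_ j)
  -- `hL j` gives only `π^j`; the detour through index `j + 1` recovers the missing factor.
  · rw [← sub_add_sub_cancel _ (Quotient.out (a.1 (j + 1)) ^ cardRes p F ^ (j + 1))]
    exact dvd_add (hL (j + 1)) (dvd_lift_pow_sub hl' j)
  · rw [← Ideal.mem_span_singleton, ← Ideal.Quotient.eq, hl, hl']

theorem tendsto_sharp {a : EPlusQ π} {l : ℕ → 𝓞_ℂ_[p]}
    (hl : ∀ j, Ideal.Quotient.mk _ (l j) = a.1 j) :
    Tendsto (fun j => l j ^ cardRes p F ^ j) atTop (𝓝 (sharp a)) :=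
  tendsto_of_pow_dvd (norm_uniformizer_lt_one π) fun j =>
    (pow_dvd_pow _ j.le_succ).trans (dvd_sharp_sub hl j)

variable (π) in
/-- The inverse of the `q`-power map of `lim_{x ↦ x^q} 𝓞_{ℂ_F}/(π)`, which shifts sequences. -/
noncomputable def powLimitRoot : EPlusQ π →ₐ[IntF p F] EPlusQ π :=
  (AlgHom.pi fun i => powLimitProj π (cardRes p F) 𝓞_ℂ_[p] (i + 1)).codRestrict _
    fun x i => x.2 (i + 1)

theorem powLimitRoot_pow (x : EPlusQ π) : powLimitRoot π x ^ cardRes p F = x :=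
  Subtype.ext (funext fun i => x.2 i)

theorem coeff_powLimitRoot_pow (n : ℕ) (x : EPlusQ π) (j : ℕ) :
    ((powLimitRoot π ^ n) x).1 j = x.1 (j + n) := by
  induction n generalizing x with
  | zero => rfl
  | succ n ih =>
    rw [pow_succ, AlgHom.mul_apply, ih]
    rfl

/-- The zeroth component of the first term of a compatible system is the value of Fontaine's map on
the corresponding expansion. -/
theorem hasSum_wittTheta (x : Witt.frobLimit (IntF p F) π (cardRes p F) 𝓞_ℂ_[p]) :
    HasSum (fun i => algebraMap (IntF p F) 𝓞_ℂ_[p] π ^ i * sharp ((powLimitRoot π ^ i)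
      ((permute π (cardRes p F) 𝓞_ℂ_[p] (reduce π (cardRes p F) 𝓞_ℂ_[p] x)).coeff i)))
      (wittTheta π x) := by
  refine hasSum_of_pow_dvd (norm_uniformizer_lt_one π) ?_
  rintro (_ | n)
  · simp
  -- Moving one step along the limit shifts ghost components by one, so the `n`-th ghost component
  -- of the `n`-th term does not depend on `n`.
  have hghost : ∀ n, wittTheta π x = ghost π (cardRes p F) (x.1 n).coeff n := by
    intro n
    have : ∀ m, ghost π (cardRes p F) (x.1 n).coeff (m + n) =
        ghost π (cardRes p F) (x.1 0).coeff m := by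
      induction n with
      | zero => simp
      | succ n ih =>
        intro m
        rw [← ih m, ← x.2 n, Witt.ghost_frob, add_assoc]
    have h0 := this 0
    rw [zero_add, ghost_zero] at h0
    exact h0.symm
  rw [hghost n, ghost, ← sum_sub_distrib]
  refine dvd_sum fun i hi => ?_
  have hi : i ≤ n := by simpa [Nat.lt_succ_iff] using hi
  rw [← mul_sub, ← dvd_neg, ← mul_neg, neg_sub]
  have e : n + 1 = i + (n - i + 1) := by omega
  conv_lhs => rw [e, pow_add]
  -- Taking `i` roots shifts indices by `i`, so the `i`-th component of the term `j + i` lifts the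
  -- `j`-th entry. At `j = n - i` this is the entry occurring in the ghost component, with error
  -- `π^(n-i+1)`.
  have h := dvd_sharp_sub (π := π) (a := (powLimitRoot π ^ i)
      ((permute π (cardRes p F) 𝓞_ℂ_[p] (reduce π (cardRes p F) 𝓞_ℂ_[p] x)).coeff i))
    (l := fun j => (x.1 (j + i)).coeff i)
    (fun j => by rw [coeff_powLimitRoot_pow]; rfl) (n - i)
  rw [Nat.sub_add_cancel hi] at h
  exact mul_dvd_mul_left _ h

end localField

end RamifiedWitt

namespace RamifiedWitt

open Finset
open scoped TensorProduct

/-! ### `𝓞_F` is finite free over `W(k_F)` -/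

theorem AdicallyComplete.of_isAdicComplete {R : Type*} [CommRing R] (t : R)
    [IsAdicComplete (Ideal.span {t}) R] : AdicallyComplete t where
  eq_zero_of_forall_dvd x hx := IsHausdorff.haus (I := Ideal.span {t}) inferInstance x fun n => by
    rw [SModEq.zero, smul_eq_mul, Ideal.mul_top, Ideal.span_singleton_pow,
      Ideal.mem_span_singleton]
    exact hx n
  exists_limit f hf := by
    obtain ⟨L, hL⟩ := IsPrecomplete.prec (I := Ideal.span {t}) inferInstance (f := f)
      fun {m n} hmn => by
        rw [SModEq.comm, SModEq.sub_mem, smul_eq_mul, Ideal.mul_top, Ideal.span_singleton_pow,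
          Ideal.mem_span_singleton]
        exact pow_dvd_sub_of_le hf hmn
    refine ⟨L, fun n => ?_⟩
    have := (hL n).symm
    rwa [SModEq.sub_mem, smul_eq_mul, Ideal.mul_top, Ideal.span_singleton_pow,
      Ideal.mem_span_singleton] at this

/-! ### Torsion-freeness and completeness from a basis. -/

section basis

variable {R T ι : Type*} [CommRing R] [CommRing T] [Algebra R T] {t : R}

/-- Divisibility by `t^n` is tested on coordinates; finiteness allows the coordinate limits to be
reassembled. -/
theorem AdicallyComplete.of_basis [Finite ι] (h : AdicallyComplete t) (b : Module.Basis ι R T) :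
    AdicallyComplete (algebraMap R T t) where
  eq_zero_of_forall_dvd x hx := b.repr.map_eq_zero_iff.1 (Finsupp.ext fun i =>
    h.eq_zero_of_forall_dvd _ fun n => by
      obtain ⟨y, rfl⟩ := hx n
      rw [← map_pow, ← Algebra.smul_def, map_smul, Finsupp.smul_apply, smul_eq_mul]
      exact dvd_mul_right _ _)
  exists_limit f hf := by
    have := Fintype.ofFinite ι
    have hcoord : ∀ i n, t ^ n ∣ b.repr (f (n + 1)) i - b.repr (f n) i := fun i n => by
      obtain ⟨y, hy⟩ := hf n
      rw [← Finsupp.sub_apply, ← map_sub, hy, ← map_pow, ← Algebra.smul_def, map_smul,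
        Finsupp.smul_apply, smul_eq_mul]
      exact dvd_mul_right _ _
    choose L hL using fun i => h.exists_limit (fun n => b.repr (f n) i) (hcoord i)
    refine ⟨∑ i, L i • b i, fun n => ?_⟩
    conv_rhs => rw [← b.sum_repr (f n), ← sum_sub_distrib]
    refine dvd_sum fun i _ => ?_
    obtain ⟨c, hc⟩ := hL i n
    rw [← sub_smul, hc, mul_smul, Algebra.smul_def (t ^ n), map_pow]
    exact dvd_mul_right _ _

theorem regular_of_basis (h : ∀ x : R, t * x = 0 → x = 0) (b : Module.Basis ι R T) (x : T)
    (hx : algebraMap R T t * x = 0) : x = 0 :=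
  b.repr.map_eq_zero_iff.1 (Finsupp.ext fun i => h _ (by
    rw [← Algebra.smul_def] at hx
    rw [← smul_eq_mul, ← Finsupp.smul_apply, ← map_smul, hx, map_zero, Finsupp.zero_apply]))

end basis

section uniformizer

variable {p : ℕ} [Fact p.Prime] {F : Type*} [Field F] [Algebra F ℂ_[p]]

theorem exists_p_dvd_uniformizer_pow (π : IntF p F)
    [hπ : Fact (Ideal.span {π} = IsLocalRing.maximalIdeal (IntF p F))] :
    ∃ M, (p : IntF p F) ∣ π ^ M := by
  obtain ⟨M, hM⟩ := exists_p_dvd_pow π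
  refine ⟨M, ?_⟩
  rw [← map_pow, ← map_natCast (algebraMap (IntF p F) 𝓞_ℂ_[p]), complexInt_dvd_iff] at hM
  exact (dvd_iff_norm_le _ _).2 hM

theorem uniformizer_dvd_p (π : IntF p F)
    [hπ : Fact (Ideal.span {π} = IsLocalRing.maximalIdeal (IntF p F))] :
    π ∣ (p : IntF p F) := by
  rw [← Ideal.mem_span_singleton, hπ.out]
  exact natCast_mem_maximalIdeal

end uniformizer

section localField

variable (p : ℕ) [Fact p.Prime] (F : Type*) [Field F] [Algebra ℚ_[p] F] [FiniteDimensional ℚ_[p] F]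
  [Algebra F ℂ_[p]] [IsScalarTower ℚ_[p] F ℂ_[p]]

theorem wittVector_adicallyComplete (E : Type*) [CommRing E] [CharP E p] [PerfectRing E p] :
    AdicallyComplete (p : WittVector p E) := .of_isAdicComplete _

/-- A nonzero element of `W(k_F)` is a power of `p` times a unit, and `p ≠ 0` in the domain `𝓞_F`.
-/
theorem algebraMap_witt_injective :
    Function.Injective (algebraMap (WittVector p (ResF p F)) (IntF p F)) := by
  rw [injective_iff_map_eq_zero]
  intro w hw
  by_contra hne
  obtain ⟨n, u, rfl⟩ := WittVector.exists_eq_pow_p_mul' w hne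
  rw [map_mul, map_pow, map_natCast] at hw
  rcases mul_eq_zero.1 hw with h | h
  · exact natCast_ne_zero (eq_zero_of_pow_eq_zero h)
  · exact (u.isUnit.map (algebraMap (WittVector p (ResF p F)) (IntF p F))).ne_zero h

variable {p F}
theorem exists_eq_algebraMap_witt_add (π : IntF p F)
    [hπ : Fact (Ideal.span {π} = IsLocalRing.maximalIdeal (IntF p F))]
    (a : IntF p F) :
    ∃ (w : WittVector p (ResF p F)) (a' : IntF p F), a = algebraMap _ _ w + π * a' := by
  let w := WittVector.teichmuller p (IsLocalRing.residue (IntF p F) a)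
  have h : a - algebraMap _ _ w ∈ Ideal.span {π} := by
    rw [hπ.out, ← IsLocalRing.residue_eq_zero_iff, map_sub, residue_algebraMap_witt,
      WittVector.teichmuller_coeff_zero, sub_self]
  obtain ⟨a', ha'⟩ := Ideal.mem_span_singleton.1 h
  exact ⟨w, a', by rw [← ha']; ring⟩

/-- The powers `π^i` with `i < M` generate `𝓞_F` modulo `p`, because `k_F` is the residue field and
`p ∣ π^M`. Successive approximation lifts this to `𝓞_F`: coefficients converge in the complete ring
`W(k_F)`, and `𝓞_F` is `p`-adically separated. -/
theorem finite_witt (π : IntF p F)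
    [Fact (Ideal.span {π} = IsLocalRing.maximalIdeal (IntF p F))] :
    Module.Finite (WittVector p (ResF p F)) (IntF p F) := by
  obtain ⟨M, d, hM⟩ := exists_p_dvd_uniformizer_pow π
  let f : (Fin M → WittVector p (ResF p F)) →ₗ[WittVector p (ResF p F)] IntF p F :=
    Fintype.linearCombination _ fun i : Fin M => π ^ (i : ℕ)
  have hf : ∀ v, f v = ∑ i : Fin M, v i • π ^ (i : ℕ) := fun v => rfl
  have step : ∀ a : IntF p F, ∃ v a', a = f v + p * a' := by
    choose w g hg using exists_eq_algebraMap_witt_add π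
    intro a
    -- The remainder after `M` steps is `π^M * g^[M] a`, and `π^M = p * d`.
    refine ⟨fun i => w (g^[i] a), d * g^[M] a, ?_⟩
    rw [← mul_assoc, ← hM, hf, Fin.sum_univ_eq_sum_range (fun i => w (g^[i] a) • π ^ i)]
    clear hf f hM
    induction M with
    | zero => simp
    | succ n ih =>
      rw [sum_range_succ, Function.iterate_succ_apply', Algebra.smul_def]
      conv_lhs => rw [ih, hg (g^[n] a)]
      ring
  choose v g hg using step
  refine Module.Finite.of_surjective f fun a => ?_
  have hW := wittVector_adicallyComplete p (ResF p F)
  choose L hL using fun i => hW.exists_limit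
    (fun n => ∑ k ∈ range n, (p : WittVector p (ResF p F)) ^ k * v (g^[k] a) i) fun n => by
      rw [sum_range_succ, add_sub_cancel_left]; exact dvd_mul_right _ _
  refine ⟨L, ?_⟩
  have hA : AdicallyComplete (p : IntF p F) := .of_isAdicComplete _
  refine hA.eq_of_forall_dvd fun n => ?_
  choose c hc using fun i => hL i n
  have h1 : L = (p : WittVector p (ResF p F)) ^ n • c +
      ∑ k ∈ range n, (p : WittVector p (ResF p F)) ^ k • v (g^[k] a) := by
    funext i
    rw [Pi.add_apply, Pi.smul_apply, smul_eq_mul, ← hc, Finset.sum_apply]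
    simp
  have h2 : a = (∑ k ∈ range n, (p : IntF p F) ^ k * f (v (g^[k] a))) + p ^ n * g^[n] a := by
    clear hc h1 c
    induction n with
    | zero => simp
    | succ n ih =>
      rw [sum_range_succ, Function.iterate_succ_apply']
      conv_lhs => rw [ih, hg (g^[n] a)]
      ring
  have h3 := congrArg f h1
  simp only [map_add, map_smul, map_sum] at h3
  simp only [Algebra.smul_def, map_pow, map_natCast] at h3
  exact ⟨f c - g^[n] a, by linear_combination h3 - h2⟩

/-- A finite torsion free module over the principal ideal domain `W(k_F)` is free. -/
theorem free_witt (π : IntF p F)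
    [Fact (Ideal.span {π} = IsLocalRing.maximalIdeal (IntF p F))] :
    Module.Free (WittVector p (ResF p F)) (IntF p F) := by
  have := finite_witt π
  have : FaithfulSMul (WittVector p (ResF p F)) (IntF p F) :=
    (faithfulSMul_iff_algebraMap_injective _ _).2 (algebraMap_witt_injective p F)
  have : Module.IsTorsionFree (WittVector p (ResF p F)) (IntF p F) := inferInstance
  infer_instance

end localField

end RamifiedWitt

namespace RamifiedWitt

open Finset
open scoped TensorProduct

/-! ### `W(E) ⊗ 𝓞_F` is the strict lift of `E` -/

section wittTensor

variable {p : ℕ} [Fact p.Prime] {F : Type*} [Field F] [Algebra ℚ_[p] F] [FiniteDimensional ℚ_[p] F]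
  [Algebra F ℂ_[p]] [IsScalarTower ℚ_[p] F ℂ_[p]]

section residue

variable (p F) (E : Type*) [CommRing E] [Algebra (ResF p F) E]

/-- The multiplicative map `a ↦ [a] ⊗ 1`. -/
noncomputable def tensorTeichmuller : E →* WittTensor p F E :=
  (Algebra.TensorProduct.includeLeftRingHom : WittVector p E →+* WittTensor p F E).toMonoidHom.comp
    (WittVector.teichmuller p)

variable [Algebra (IntF p F) E] [IsScalarTower (IntF p F) (ResF p F) E]

/-- The maps `w ↦ w_0` on `W(E)` and `𝓞_F → k_F → E` agree on `W(k_F)`, since `W(k_F) → 𝓞_F` lifts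
the identity of `k_F`. The auxiliary `W(k_F)`-algebra structure on `E` stays inside the proof. -/
theorem exists_tensorResidue : ∃ ρ : WittTensor p F E →ₐ[IntF p F] E,
    ∀ w : WittVector p E, ρ (w ⊗ₜ 1) = w.coeff 0 := by
  let _ : Algebra (WittVector p (ResF p F)) E :=
    ((algebraMap (ResF p F) E).comp WittVector.constantCoeff).toAlgebra
  let f : WittVector p E →ₐ[WittVector p (ResF p F)] E :=
    { (WittVector.constantCoeff : WittVector p E →+* E) with
      commutes' := fun _ => rfl }
  let g : IntF p F →ₐ[WittVector p (ResF p F)] E :=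
    { algebraMap (IntF p F) E with
      commutes' := fun w => by
        change algebraMap (IntF p F) E (algebraMap _ _ w) = algebraMap (ResF p F) E (w.coeff 0)
        rw [← residue_algebraMap_witt, IsScalarTower.algebraMap_apply (IntF p F) (ResF p F) E]
        rfl }
  refine ⟨{ (Algebra.TensorProduct.productMap f g).toRingHom with
    commutes' := fun a => ?_ }, fun w => ?_⟩
  · have h := Algebra.TensorProduct.productMap_apply_tmul f g 1 a
    rw [map_one, one_mul] at h
    exact h
  · have h := Algebra.TensorProduct.productMap_apply_tmul f g w 1
    rw [map_one, mul_one] at h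
    exact h

/-- The reduction map `W(E) ⊗ 𝓞_F → E`, given by the zeroth Witt component. -/
noncomputable def tensorResidue : WittTensor p F E →ₐ[IntF p F] E :=
  (exists_tensorResidue p F E).choose

variable {p F E} in
theorem tensorResidue_tmul_one (w : WittVector p E) :
    tensorResidue p F E (w ⊗ₜ 1) = w.coeff 0 :=
  (exists_tensorResidue p F E).choose_spec w

end residue

variable (π : IntF p F) {E : Type*} [CommRing E] [Algebra (ResF p F) E]

theorem tensor_algebraMap_mul_tmul (w : WittVector p E) (a : IntF p F) :
    algebraMap (IntF p F) (WittTensor p F E) π * w ⊗ₜ a = w ⊗ₜ (π * a) := by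
  rw [Algebra.TensorProduct.right_algebraMap_apply, Algebra.TensorProduct.tmul_mul_tmul, one_mul]

variable {π} in
theorem isExpansion_tensorTeichmuller_iff {a : ℕ → E} {z : WittTensor p F E} :
    IsExpansion π (tensorTeichmuller p F E) a z ↔
      ∀ n, z - ∑ i ∈ range n, WittVector.teichmuller p (a i) ⊗ₜ (π ^ i) ∈
        Ideal.span {algebraMap (IntF p F) (WittTensor p F E) π} ^ n := by
  refine forall_congr' fun n => ?_
  rw [Ideal.span_singleton_pow, Ideal.mem_span_singleton]
  have : ∀ i, algebraMap (IntF p F) (WittTensor p F E) π ^ i * tensorTeichmuller p F E (a i) =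
      WittVector.teichmuller p (a i) ⊗ₜ (π ^ i) := fun i => by
    rw [← map_pow]
    exact (tensor_algebraMap_mul_tmul _ _ _).trans (by rw [mul_one])
  simp only [this]

variable [hπ : Fact (Ideal.span {π} = IsLocalRing.maximalIdeal (IntF p F))]

/-- Modulo `π` every element of `𝓞_F` comes from `W(k_F)` and can be moved across the tensor sign.
-/
theorem exists_tensor_dvd_sub (z : WittTensor p F E) : ∃ w : WittVector p E,
    algebraMap (IntF p F) (WittTensor p F E) π ∣ z - w ⊗ₜ 1 := by
  induction z using TensorProduct.induction_on with
  | zero => exact ⟨0, by simp⟩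
  | tmul x a =>
    obtain ⟨w, a', rfl⟩ := exists_eq_algebraMap_witt_add π a
    refine ⟨w • x, x ⊗ₜ a', ?_⟩
    rw [tensor_algebraMap_mul_tmul, TensorProduct.tmul_add, Algebra.algebraMap_eq_smul_one,
      TensorProduct.tmul_smul, TensorProduct.smul_tmul']
    exact add_sub_cancel_left _ _
  | add x y hx hy =>
    obtain ⟨v, hv⟩ := hx
    obtain ⟨w, hw⟩ := hy
    exact ⟨v + w, by
      rw [TensorProduct.add_tmul, add_sub_add_comm]
      exact dvd_add hv hw⟩

variable [CharP E p] [PerfectRing E p] [Algebra (IntF p F) E]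
  [IsScalarTower (IntF p F) (ResF p F) E]

theorem isStrictLift_wittTensor :
    IsStrictLift π (tensorResidue p F E) (tensorTeichmuller p F E) := by
  have := finite_witt π
  have := free_witt π
  let b := Algebra.TensorProduct.basis (WittVector p E)
    (Module.Free.chooseBasis (WittVector p (ResF p F)) (IntF p F))
  have hdvd := map_dvd (algebraMap (IntF p F) (WittTensor p F E)) (uniformizer_dvd_p π)
  obtain ⟨M, hM⟩ := exists_p_dvd_uniformizer_pow π
  have hM := map_dvd (algebraMap (IntF p F) (WittTensor p F E)) hM
  rw [map_natCast] at hdvd hM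
  rw [map_pow] at hM
  have hcast : algebraMap (WittVector p E) (WittTensor p F E) p = p := map_natCast _ p
  have hreg : ∀ x : WittTensor p F E, (p : WittTensor p F E) * x = 0 → x = 0 := by
    intro x hx
    rw [← hcast] at hx
    exact regular_of_basis (fun w hw =>
      WittVector.eq_zero_of_p_mul_eq_zero w (by rwa [mul_comm])) b x hx
  have hcomp : AdicallyComplete (p : WittTensor p F E) := by
    rw [← hcast]
    exact (wittVector_adicallyComplete p E).of_basis b
  have hp : algebraMap (IntF p F) E π = 0 := by
    rw [IsScalarTower.algebraMap_apply (IntF p F) (ResF p F) E,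
      IsLocalRing.ResidueField.algebraMap_eq, (IsLocalRing.residue_eq_zero_iff π).2, map_zero]
    rw [← hπ.out]
    exact Ideal.mem_span_singleton_self _
  -- Torsion-freeness and completeness pass from `p` to `π` by `π ∣ p ∣ π^M`. For the kernel: `x ≡ w
  -- ⊗ 1` modulo `π` with `w_0 = 0`, hence `p ∣ w` as `E` is perfect, and `π ∣ p`.
  refine ⟨fun x hx => hreg x ?_, hcomp.of_dvd hdvd hM, fun x hx => ?_, hp, fun a => ?_⟩
  · obtain ⟨c, hc⟩ := hdvd
    rw [hc, mul_right_comm, hx, zero_mul]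
  · obtain ⟨w, hw⟩ := exists_tensor_dvd_sub π x
    have h0 : w.coeff 0 = 0 := by
      obtain ⟨c, hc⟩ := hw
      have := congrArg (tensorResidue p F E) hc
      rwa [map_sub, hx, tensorResidue_tmul_one, map_mul, AlgHom.commutes, hp, zero_mul,
        zero_sub, neg_eq_zero] at this
    rw [← WittVector.mem_span_p_iff_coeff_zero_eq_zero, Ideal.mem_span_singleton] at h0
    have h1 := map_dvd (algebraMap (WittVector p E) (WittTensor p F E)) h0
    rw [hcast] at h1
    have h2 := dvd_add hw (hdvd.trans h1)
    rwa [Algebra.TensorProduct.algebraMap_apply, Algebra.algebraMap_self_apply,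
      sub_add_cancel] at h2
  · exact (tensorResidue_tmul_one _).trans (WittVector.teichmuller_coeff_zero p a)

end wittTensor

/-! ### Expansions in `W(E_q) ⊗ 𝓞_F`, and existence and uniqueness of `γ`. -/

section localField

variable {p : ℕ} [Fact p.Prime] {F : Type*} [Field F] [Algebra ℚ_[p] F] [FiniteDimensional ℚ_[p] F]
  [Algebra F ℂ_[p]] [IsScalarTower ℚ_[p] F ℂ_[p]]
variable (π : IntF p F) [hπ : Fact (Ideal.span {π} = IsLocalRing.maximalIdeal (IntF p F))]

instance : IsScalarTower (IntF p F) (ResF p F) (EPlusQ π) :=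
  .of_algebraMap_eq fun a => (algebraMap_residue π a).symm

instance : CharP (EPlusQ π) p :=
  charP_of_injective_ringHom
    (f := ((tiltEquiv π : EPlus p ≃ₐ[ResF p F] EPlusQ π) : EPlus p →+* EPlusQ π))
    (tiltEquiv π).injective p

instance : PerfectRing (EPlusQ π) p where
  bijective_frobenius := by
    have h : ⇑(frobenius (EPlusQ π) p) =
        tiltEquiv π ∘ frobenius (EPlus p) p ∘ (tiltEquiv π).symm := by
      funext x
      simp [frobenius_def]
    change Function.Bijective ⇑(frobenius (EPlusQ π) p)
    rw [h]
    exact (tiltEquiv π).bijective.comp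
      ((PerfectRing.bijective_frobenius).comp (tiltEquiv π).symm.bijective)

theorem isTeichmullerSum_iff {a : ℕ → EPlusQ π} {z : WittTensor p F (EPlusQ π)} :
    IsTeichmullerSum π a z ↔ IsExpansion π (tensorTeichmuller p F (EPlusQ π)) a z :=
  isExpansion_tensorTeichmuller_iff.symm

theorem existsUnique_isTeichmullerSum (z : WittTensor p F (EPlusQ π)) :
    ∃! a : ℕ → EPlusQ π, IsTeichmullerSum π a z := by
  obtain ⟨a, ha⟩ := (isStrictLift_wittTensor (E := EPlusQ π) π).exists_expansion z
  exact ⟨a, (isTeichmullerSum_iff π).2 ha, fun b hb =>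
    (isStrictLift_wittTensor π).expansion_unique ((isTeichmullerSum_iff π).1 hb) ha⟩

/-- Uniqueness of expansions identifies the digits chosen in `theta` with `a`; the series converges
because its `i`-th term is divisible by `π^i`. -/
theorem hasSum_theta {z : WittTensor p F (EPlusQ π)} {a : ℕ → EPlusQ π}
    (ha : IsTeichmullerSum π a z) :
    HasSum (fun i => algebraMap (IntF p F) 𝓞_ℂ_[p] π ^ i * sharp (a i)) (theta π z) := by
  have h1 : digits π z = a := (existsUnique_isTeichmullerSum π z).unique
    (Classical.epsilon_spec (existsUnique_isTeichmullerSum π z).exists) ha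
  rw [theta, h1]
  refine Summable.hasSum ?_
  obtain ⟨L, hL⟩ := (complexInt_adicallyComplete (norm_uniformizer_lt_one π)).exists_limit
    (fun n => ∑ i ∈ range n, algebraMap (IntF p F) 𝓞_ℂ_[p] π ^ i * sharp (a i)) fun n => by
      rw [sum_range_succ, add_sub_cancel_left]; exact dvd_mul_right _ _
  exact (hasSum_of_pow_dvd (norm_uniformizer_lt_one π) hL).summable

/-- `wittTensorEquiv` is linear over `𝓞_F`. -/
noncomputable def wittTensorAlgEquiv :
    WittTensor p F (EPlus p) ≃ₐ[IntF p F] WittTensor p F (EPlusQ π) :=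
  AlgEquiv.ofRingEquiv (f := wittTensorEquiv π) fun a => by
    change wittTensorEquiv π (1 ⊗ₜ a) = 1 ⊗ₜ a
    refine (Algebra.TensorProduct.map_tmul _ _ _ _).trans ?_
    rw [map_one]
    rfl

theorem wittTensorAlgEquiv_teichmuller (e : EPlus p) :
    wittTensorAlgEquiv π (WittVector.teichmuller p e ⊗ₜ 1) =
      WittVector.teichmuller p (tiltEquiv π e) ⊗ₜ 1 := by
  refine (Algebra.TensorProduct.map_tmul _ _ _ _).trans ?_
  rw [map_one]
  congr 1
  exact WittVector.map_teichmuller p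
    ((tiltEquiv π : EPlus p ≃ₐ[ResF p F] EPlusQ π) : EPlus p →+* EPlusQ π) e

/-- Transport of the condition `IsResidual` to `W(lim_{x ↦ x^q} 𝓞_{ℂ_F}/(π)) ⊗ 𝓞_F`. -/
theorem isResidual_iff
    (γ : Witt (IntF p F) π (cardRes p F) (EPlusQ π) ≃ₐ[IntF p F] WittTensor p F (EPlus p)) :
    IsResidual π γ ↔ ∀ w, tensorResidue p F (EPlusQ π) (wittTensorAlgEquiv π (γ w)) = w.coeff 0 := by
  refine forall_congr' fun w => ?_
  rw [Ideal.mem_span_singleton, ← map_dvd_iff (wittTensorAlgEquiv π), AlgEquiv.commutes, map_sub,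
    wittTensorAlgEquiv_teichmuller, AlgEquiv.apply_symm_apply,
    (isStrictLift_wittTensor π).dvd_sub_iff, tensorResidue_tmul_one,
    WittVector.teichmuller_coeff_zero]

/-- Besides existence, this records the digits of `γ x`, which the comparison with `theta` needs. -/
theorem exists_residual_expansion :
    ∃ γ : Witt (IntF p F) π (cardRes p F) (EPlusQ π) ≃ₐ[IntF p F] WittTensor p F (EPlus p),
      IsResidual π γ ∧ ∀ x, IsTeichmullerSum π (fun i => (powLimitRoot π ^ i) (x.coeff i))
        (wittTensorEquiv π (γ x)) := by
  have h := isStrictLift_wittTensor (E := EPlusQ π) π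
  obtain ⟨γ, hγ⟩ := h.exists_witt_equiv (powLimitRoot_pow (π := π))
  have e : ∀ x, wittTensorAlgEquiv π ((γ.trans (wittTensorAlgEquiv π).symm) x) = γ x := fun x =>
    (wittTensorAlgEquiv π).apply_symm_apply _
  refine ⟨γ.trans (wittTensorAlgEquiv π).symm, (isResidual_iff π _).2 fun w => ?_, fun x => ?_⟩
  · rw [e]
    -- Modulo `π` only the digit of index `0` survives, and it is `w_0` because `r ^ 0` is the
    -- identity.
    have h1 := hγ w 1
    rw [pow_one] at h1
    simp only [range_one, sum_singleton, pow_zero, one_mul] at h1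
    rw [h.dvd_sub_iff, h.map_section] at h1
    exact h1
  · rw [isTeichmullerSum_iff]
    exact (e x).symm ▸ hγ x

/-- Transported to `W(E_q) ⊗ 𝓞_F`, the composite of `γ⁻¹` and `γ'` induces the identity on `E_q`, so
rigidity of strict lifts applies. -/
theorem residual_unique
    {γ γ' : Witt (IntF p F) π (cardRes p F) (EPlusQ π) ≃ₐ[IntF p F] WittTensor p F (EPlus p)}
    (hγ : IsResidual π γ) (hγ' : IsResidual π γ') : γ = γ' := by
  rw [isResidual_iff] at hγ hγ'
  have h := (isStrictLift_wittTensor (E := EPlusQ π) π).endomorphism_eq_id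
    (powLimitRoot_pow (π := π))
    ((((wittTensorAlgEquiv π).symm.trans γ.symm).trans γ').trans
      (wittTensorAlgEquiv π)).toAlgHom fun z => by
        have h1 := hγ (γ.symm ((wittTensorAlgEquiv π).symm z))
        rw [γ.apply_symm_apply, AlgEquiv.apply_symm_apply] at h1
        exact (hγ' _).trans h1.symm
  refine AlgEquiv.ext fun w => ((wittTensorAlgEquiv π).injective ?_).symm
  have h1 := h (wittTensorAlgEquiv π (γ w))
  change wittTensorAlgEquiv π (γ' (γ.symm ((wittTensorAlgEquiv π).symm _))) = _ at h1
  rwa [AlgEquiv.symm_apply_apply, AlgEquiv.symm_apply_apply] at h1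

end localField

end RamifiedWitt

open RamifiedWitt Filter
open scoped TensorProduct Topology

theorem mainTheorem6 (p : ℕ) [Fact p.Prime] (F : Type*) [Field F] [Algebra ℚ_[p] F]
    [FiniteDimensional ℚ_[p] F] [Algebra F ℂ_[p]] [IsScalarTower ℚ_[p] F ℂ_[p]]
    (π : IntF p F) [Fact (Ideal.span {π} = IsLocalRing.maximalIdeal (IntF p F))] :
    -- `θ` is well defined: expansions exist and are unique, the limits exist and do not depend on
    -- the lifts, and the sums converge
    (∀ z : WittTensor p F (EPlusQ π), ∃! a : ℕ → EPlusQ π, IsTeichmullerSum π a z) ∧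
    (∀ (a : EPlusQ π) (l : ℕ → 𝓞_ℂ_[p]), (∀ j, Ideal.Quotient.mk _ (l j) = a.1 j) →
      Tendsto (fun j => l j ^ cardRes p F ^ j) atTop (𝓝 (sharp a))) ∧
    (∀ (z : WittTensor p F (EPlusQ π)) (a : ℕ → EPlusQ π), IsTeichmullerSum π a z →
      HasSum (fun i => algebraMap (IntF p F) 𝓞_ℂ_[p] π ^ i * sharp (a i)) (theta π z)) ∧
    -- the three maps of the comparison are isomorphisms
    Function.Bijective (reduce π (cardRes p F) 𝓞_ℂ_[p]) ∧
    Function.Bijective (permute π (cardRes p F) 𝓞_ℂ_[p]) ∧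
    (∃! γ : Witt (IntF p F) π (cardRes p F) (EPlusQ π) ≃ₐ[IntF p F] WittTensor p F (EPlus p),
      IsResidual π γ) ∧
    -- the two `θ` maps agree
    (∀ γ : Witt (IntF p F) π (cardRes p F) (EPlusQ π) ≃ₐ[IntF p F] WittTensor p F (EPlus p),
      IsResidual π γ → ∀ x : Witt.frobLimit (IntF p F) π (cardRes p F) 𝓞_ℂ_[p],
        theta π (wittTensorEquiv π
          (γ (permute π (cardRes p F) 𝓞_ℂ_[p] (reduce π (cardRes p F) 𝓞_ℂ_[p] x)))) =
        wittTheta π x) := by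
  refine ⟨existsUnique_isTeichmullerSum π, fun a l hl => tendsto_sharp hl,
    fun z a ha => hasSum_theta π ha,
    ⟨reduce_injective (complexInt_uniformizer_regular π)
      (complexInt_adicallyComplete (norm_uniformizer_lt_one π)),
    reduce_surjective (complexInt_uniformizer_regular π)
      (complexInt_adicallyComplete (norm_uniformizer_lt_one π))⟩, permute_bijective, ?_, ?_⟩
  · obtain ⟨γ, hγ, -⟩ := exists_residual_expansion π
    exact ⟨γ, hγ, fun γ' hγ' => residual_unique π hγ' hγ⟩
  · intro γ hγ x
    obtain ⟨γ', hγ', hexp⟩ := exists_residual_expansion π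
    -- By uniqueness `γ` is the isomorphism with known digits; then both sides are sums of the same
    -- convergent series.
    rw [residual_unique π hγ hγ']
    exact (hasSum_theta π (hexp _)).unique (hasSum_wittTheta x)
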